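/- Let $P$ be a Markov transition kernel on a measurable space $S$, and suppose the following two conditions hold. (A1) There are a measurable set $C\subseteq S$, a constant $\tilde\beta$ and a probability measure $\nu$ on $S$ with $P(x,A)\ge\tilde\beta\,\nu(A)$ for all $x\in C$ and all measurable $A$; moreover $0<\tilde\beta<1$. (A2) There are a measurable $V:S\to[1,\infty)$ and constants $0<\lambda<1$, $K<\infty$ with $PV(x)\le\lambda V(x)$ for $x\notin C$ and $PV(x)\le K$ for $x\in C$. Let $(X_n)_{n\ge0}$ be the Markov chain with kernel $P$, let $\tau=\inf\{n\ge1:X_n\in C\}$, and set $$G(r,x)=\mathbf E^x(r^\tau),\qquad H(r,x)=\mathbf E^x\Big(\sum_{n=1}^{\tau}r^nV(X_n)\Big).$$ The split chain $(X_n,Y_n)_{n\ge 0}$ is the Markov chain on $S\times\{0,1\}$ which, given $(X_n,Y_n)$, moves as follows. If $Y_n=1$ then $X_{n+1}\sim\nu$; if $Y_n=0$ then $$X_{n+1}\sim \frac{P(X_n,\cdot)-\tilde\beta\mathbf 1_C(X_n)\,\nu}{1-\tilde\beta\mathbf 1_C(X_n)};$$ and then $Y_{n+1}=1$ with conditional probability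 $\tilde\beta\mathbf 1_C(X_{n+1})$, and $Y_{n+1}=0$ otherwise. Let $\bar{\mathbf E}^{x,i}$ be expectation for the split chain started at $(x,i)$, let $T=\inf\{n\ge1:Y_n=1\}$, and set $$\bar G(r,x,i)=\bar{\mathbf E}^{x,i}(r^T),\qquad \bar H(r,x,i)=\bar{\mathbf E}^{x,i}\Big(\sum_{n=1}^{T}r^nV(X_n)\Big),$$ $$\bar G(r,x)=[1-\tilde\beta\mathbf 1_C(x)]\,\bar G(r,x,0)+\tilde\beta\mathbf 1_C(x)\,\bar G(r,x,1),$$ $$\bar H(r,x)=[1-\tilde\beta\mathbf 1_C(x)]\,\bar H(r,x,0)+\tilde\beta\mathbf 1_C(x)\,\bar H(r,x,1),$$ $$\tilde G(r)=\sup\{\bar{\mathbf E}^{x,0}(r^{\tau}):x\in C\},$$ where in the last formula $\tau=\inf\{n\ge1:X_n\in C\}$ is computed for the split chain. Fix $a\in C$ (the law started from $(x,1)$ does not depend on $x$ after time $0$), and let $$\alpha_1=1+\frac{\log\frac{K-\tilde\beta}{1-\tilde\beta}}{\log\lambda^{-1}},\qquad \alpha_2=1+\frac{\log(K/\tilde\beta)}{\log\lambda^{-1}},\qquad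 R_0=\min\big(\lambda^{-1},(1-\tilde\beta)^{-1/\alpha_1}\big).$$ Then for $1\le r\le\lambda^{-1}$ the quantity $\tilde G(r)$ is finite and $$\tilde G(r)\le r^{\alpha_1}.$$ Furthermore, for every $1<r<R_0$ and every $x\in S$, all the expectations below are finite and $$\bar G(r,x)\le\frac{\tilde\beta\,G(r,x)}{1-(1-\tilde\beta)r^{\alpha_1}},$$ $$\bar G(r,a,1)\le\frac{\tilde\beta\,r^{\alpha_2}}{1-(1-\tilde\beta)r^{\alpha_1}}\equiv L(r),$$ $$\bar H(r,x)\le H(r,x)+\frac{r[K-r\lambda-\tilde\beta(1-r\lambda)]}{(1-r\lambda)[1-(1-\tilde\beta)r^{\alpha_1}]}\,G(r,x),$$ $$\bar H(r,a,1)\le\frac{r^{\alpha_2+1}(K-r\lambda)}{(1-r\lambda)[1-(1-\tilde\beta)r^{\alpha_1}]},$$ $$\frac{\bar H(r,a,1)-r\bar H(1,a,1)}{r-1}\le\frac{r^{\alpha_2+1}\lambda(K-1)}{(1-\lambda)(1-r\lambda)[1-(1-\tilde\beta)r^{\alpha_1}]}+\frac{r[K-\lambda-\tilde\beta(1-\lambda)]}{(1-\lambda)[1-(1-\tilde\beta)r^{\alpha_1}]}\left(\frac{r^{\alpha_2}-1}{r-1}+\frac{(1-\tilde\beta)(r^{\alpha_1}-1)}{\tilde\beta(r-1)}\right).$$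 -/

import Mathlib

open MeasureTheory ProbabilityTheory
open scoped ENNReal

noncomputable section

/-! ### Homogeneous Markov chains on the path space -/

section Chain

variable {E : Type*} [MeasurableSpace E]

/-- The transition mechanism of a time homogeneous Markov chain with one-step kernel `κ`, as a
kernel that sees the whole history up to time `n` but uses only the present state. -/
def historyKernel (κ : Kernel E E) (n : ℕ) : Kernel ((_ : Finset.Iic n) → E) E :=
  κ.comap (fun h => h ⟨n, Finset.mem_Iic.2 le_rfl⟩) (measurable_pi_apply _)

instance (κ : Kernel E E) [IsMarkovKernel κ] (n : ℕ) : IsMarkovKernel (historyKernel κ n) := by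
  unfold historyKernel; infer_instance

/-- The law on the path space `ℕ → E` of the time homogeneous Markov chain with one-step kernel `κ`
started at `x` at time `0`. The chain itself is the coordinate process `n ↦ ω n`. -/
def chainLaw (κ : Kernel E E) [IsMarkovKernel κ] (x : E) : Measure (ℕ → E) :=
  Kernel.traj (X := fun _ => E) (historyKernel κ) 0 (fun _ => x)

/-- `inf {n ≥ 1 : ω n ∈ A}`, with value `⊤` if there is no such `n`. -/
def returnTime (A : Set E) (ω : ℕ → E) : ℕ∞ :=
  hittingAfter (fun n (w : ℕ → E) => w n) A 1 ω

/-- `r ^ t` for an extended natural number `t`; `r ^ ∞` is `0`, `1`, `∞` according to whether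
`r < 1`, `r = 1`, `r > 1`. -/
def stopPow (r : ℝ) (t : ℕ∞) : ℝ≥0∞ :=
  if t = ⊤ then (if r < 1 then 0 else if r = 1 then 1 else ⊤) else ENNReal.ofReal r ^ t.toNat

/-- `E^x (r ^ σ)`, where `σ = inf {n ≥ 1 : ω n ∈ A}`, for the chain with kernel `κ`. -/
def genFun (κ : Kernel E E) [IsMarkovKernel κ] (A : Set E) (r : ℝ) (x : E) : ℝ≥0∞ :=
  ∫⁻ ω, stopPow r (returnTime A ω) ∂(chainLaw κ x)

open scoped Classical in
/-- `E^x (∑_{n = 1}^σ r ^ n W (ω n))`, where `σ = inf {n ≥ 1 : ω n ∈ A}`, for the chain with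
kernel `κ`. -/
def sumFun (κ : Kernel E E) [IsMarkovKernel κ] (A : Set E) (W : E → ℝ) (r : ℝ) (x : E) : ℝ≥0∞ :=
  ∫⁻ ω, ∑' n : ℕ, (if 1 ≤ n ∧ (n : ℕ∞) ≤ returnTime A ω
    then ENNReal.ofReal (r ^ n * W (ω n)) else 0) ∂(chainLaw κ x)

end Chain

/-! ### The two standing conditions -/

section Split

variable {S : Type*} [MeasurableSpace S]

/-- Minorization condition. -/
structure Minorization (P : Kernel S S) (C : Set S) (β : ℝ) (ν : Measure S) : Prop where
  measurableSet : MeasurableSet C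
  pos : 0 < β
  isProbabilityMeasure : IsProbabilityMeasure ν
  le : ∀ x ∈ C, ∀ A : Set S, MeasurableSet A → ENNReal.ofReal β * ν A ≤ P x A

/-- Drift condition. -/
structure Drift (P : Kernel S S) (C : Set S) (V : S → ℝ) (lam K : ℝ) : Prop where
  measurable : Measurable V
  one_le : ∀ x, 1 ≤ V x
  lt_one : lam < 1
  of_notMem : ∀ x, x ∉ C → ∫⁻ y, ENNReal.ofReal (V y) ∂(P x) ≤ ENNReal.ofReal (lam * V x)
  of_mem : ∀ x ∈ C, ∫⁻ y, ENNReal.ofReal (V y) ∂(P x) ≤ ENNReal.ofReal K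

/-! ### The split chain on `S × Bool`; the labels `false`, `true` stand for `0`, `1` -/

variable {P : Kernel S S} {C : Set S} {β : ℝ} {ν : Measure S}

lemma Minorization.smul_le (h : Minorization P C β ν) {x : S} (hx : x ∈ C) :
    ENNReal.ofReal β • ν ≤ P x :=
  Measure.le_iff.2 fun A hA => by simpa using h.le x hx A hA

open scoped Classical in
/-- The law of the next position `X_{n+1}` of the split chain given the present state
`(X_n, Y_n) = (x, i)`: it is `ν` if `i = 1`; if `i = 0` it is `(P(x, ·) - β ν) / (1 - β)` for
`x ∈ C` and `P(x, ·)` for `x ∉ C`. -/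
def stepMeasure (P : Kernel S S) (C : Set S) (β : ℝ) (ν : Measure S) (p : S × Bool) : Measure S :=
  if p.2 = true then ν
  else if p.1 ∈ C then (ENNReal.ofReal (1 - β))⁻¹ • (P p.1 - ENNReal.ofReal β • ν)
  else P p.1

open scoped Classical in
lemma measurable_stepMeasure [IsMarkovKernel P] (h : Minorization P C β ν) :
    Measurable (stepMeasure P C β ν) := by
  have := h.isProbabilityMeasure
  refine Measure.measurable_of_measurable_coe _ fun A hA => ?_
  have key : (fun p : S × Bool => stepMeasure P C β ν p A) = fun p =>
      if p.2 = true then ν A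
      else if p.1 ∈ C then (ENNReal.ofReal (1 - β))⁻¹ * (P p.1 A - ENNReal.ofReal β * ν A)
      else P p.1 A := by
    funext p
    unfold stepMeasure
    split_ifs with h1 h2
    · rfl
    · have : IsFiniteMeasure (ENNReal.ofReal β • ν) := Measure.smul_finite ν ENNReal.ofReal_ne_top
      rw [Measure.smul_apply, Measure.sub_apply hA (h.smul_le h2)]
      simp
    · rfl
  rw [key]
  have hP : Measurable fun p : S × Bool => P p.1 A := (P.measurable_coe hA).comp measurable_fst
  refine Measurable.ite (measurable_snd (measurableSet_singleton true)) measurable_const ?_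
  exact Measurable.ite (measurable_fst h.measurableSet) ((hP.sub measurable_const).const_mul _) hP

/-- `stepMeasure` as a kernel. -/
def stepKernel [IsMarkovKernel P] (h : Minorization P C β ν) : Kernel (S × Bool) S where
  toFun := stepMeasure P C β ν
  measurable' := measurable_stepMeasure h

lemma isMarkovKernel_stepKernel [IsMarkovKernel P] (h : Minorization P C β ν) (hβ : β < 1) :
    IsMarkovKernel (stepKernel h) := by
  have := h.isProbabilityMeasure
  refine ⟨fun p => ⟨?_⟩⟩
  change stepMeasure P C β ν p Set.univ = 1
  unfold stepMeasure
  split_ifs with h1 h2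
  · simp
  · have : IsFiniteMeasure (ENNReal.ofReal β • ν) := Measure.smul_finite ν ENNReal.ofReal_ne_top
    rw [Measure.smul_apply, Measure.sub_apply MeasurableSet.univ (h.smul_le h2)]
    simp only [measure_univ, Measure.smul_apply, smul_eq_mul, mul_one]
    rw [ENNReal.ofReal_sub _ h.pos.le, ENNReal.ofReal_one]
    refine ENNReal.inv_mul_cancel ?_ (by simp)
    rw [Ne, tsub_eq_zero_iff_le, ENNReal.one_le_ofReal]
    exact not_le.2 hβ
  · simp

/-- The value `β 1_C(x)`, the probability that the label attached to position `x` is `1`. -/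
def labelProb (C : Set S) (β : ℝ) (x : S) : ℝ := C.indicator (fun _ => β) x

lemma measurable_labelProb (h : Minorization P C β ν) : Measurable (labelProb C β) :=
  measurable_const.indicator h.measurableSet

/-- Attach to a position `x` a random label, equal to `1` with probability `β 1_C(x)`. -/
def labelKernel (h : Minorization P C β ν) : Kernel S (S × Bool) where
  toFun x := ENNReal.ofReal (labelProb C β x) • Measure.dirac (x, true) +
    ENNReal.ofReal (1 - labelProb C β x) • Measure.dirac (x, false)
  measurable' := by
    have hl := measurable_labelProb h
    refine Measure.measurable_of_measurable_coe _ fun A hA => ?_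
    have hd : ∀ b : Bool, Measurable fun x : S => Measure.dirac (x, b) A := fun b =>
      (Measure.measurable_coe hA).comp (Measure.measurable_dirac.comp (by fun_prop))
    simp only [Measure.add_apply, Measure.smul_apply, smul_eq_mul]
    exact (hl.ennreal_ofReal.mul (hd true)).add
      ((hl.const_sub 1).ennreal_ofReal.mul (hd false))

lemma isMarkovKernel_labelKernel (h : Minorization P C β ν) (hβ : β < 1) :
    IsMarkovKernel (labelKernel h) := by
  refine ⟨fun x => ⟨?_⟩⟩
  have h0 : 0 ≤ labelProb C β x := Set.indicator_nonneg (fun _ _ => h.pos.le) x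
  have h1 : labelProb C β x ≤ 1 := by
    unfold labelProb
    by_cases hx : x ∈ C
    · simpa [hx] using hβ.le
    · simp [hx]
  change (ENNReal.ofReal (labelProb C β x) • Measure.dirac (x, true) +
    ENNReal.ofReal (1 - labelProb C β x) • Measure.dirac (x, false)) Set.univ = 1
  simp only [Measure.add_apply, Measure.smul_apply, smul_eq_mul, measure_univ, mul_one]
  rw [← ENNReal.ofReal_add h0 (by linarith)]
  simp

/-- One step of the split chain: move from `(x, i)` to a new position, then label it. The
hypothesis `β < 1` is recorded because the split chain is considered only in this case. -/
def splitKernel [IsMarkovKernel P] (h : Minorization P C β ν) (_hβ : β < 1) :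
    Kernel (S × Bool) (S × Bool) :=
  labelKernel h ∘ₖ stepKernel h

instance [IsMarkovKernel P] (h : Minorization P C β ν) (hβ : β < 1) :
    IsMarkovKernel (splitKernel h hβ) := by
  have := isMarkovKernel_labelKernel h hβ
  have := isMarkovKernel_stepKernel h hβ
  unfold splitKernel; infer_instance

/-! ### The generating functions of the original and of the split chain -/

/-- `G(r, x) = E^x (r ^ τ)` for the original chain, `τ = inf {n ≥ 1 : X_n ∈ C}`. -/
def Gorig (P : Kernel S S) [IsMarkovKernel P] (C : Set S) (r : ℝ) (x : S) : ℝ≥0∞ :=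
  genFun P C r x

/-- `H(r, x) = E^x (∑_{n = 1}^τ r ^ n V(X_n))` for the original chain. -/
def Horig (P : Kernel S S) [IsMarkovKernel P] (C : Set S) (V : S → ℝ) (r : ℝ) (x : S) : ℝ≥0∞ :=
  sumFun P C V r x

/-- `Ḡ(r, x, i)`, the expectation of `r ^ T` for the split chain started at `(x, i)`, where
`T = inf {n ≥ 1 : Y_n = 1}`. -/
def Gbar [IsMarkovKernel P] (h : Minorization P C β ν) (hβ : β < 1) (r : ℝ) (x : S) (i : Bool) :
    ℝ≥0∞ :=
  genFun (splitKernel h hβ) {p | p.2 = true} r (x, i)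

/-- `H̄(r, x, i)`, the expectation of `∑_{n = 1}^T r ^ n V(X_n)` for the split chain started
at `(x, i)`. -/
def Hbar [IsMarkovKernel P] (h : Minorization P C β ν) (hβ : β < 1) (V : S → ℝ) (r : ℝ) (x : S)
    (i : Bool) : ℝ≥0∞ :=
  sumFun (splitKernel h hβ) {p | p.2 = true} (fun p => V p.1) r (x, i)

/-- `Ḡ(r, x) = (1 - β 1_C(x)) Ḡ(r, x, 0) + β 1_C(x) Ḡ(r, x, 1)`. -/
def GbarMix [IsMarkovKernel P] (h : Minorization P C β ν) (hβ : β < 1) (r : ℝ) (x : S) : ℝ≥0∞ :=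
  ENNReal.ofReal (1 - labelProb C β x) * Gbar h hβ r x false +
    ENNReal.ofReal (labelProb C β x) * Gbar h hβ r x true

/-- `H̄(r, x) = (1 - β 1_C(x)) H̄(r, x, 0) + β 1_C(x) H̄(r, x, 1)`. -/
def HbarMix [IsMarkovKernel P] (h : Minorization P C β ν) (hβ : β < 1) (V : S → ℝ) (r : ℝ)
    (x : S) : ℝ≥0∞ :=
  ENNReal.ofReal (1 - labelProb C β x) * Hbar h hβ V r x false +
    ENNReal.ofReal (labelProb C β x) * Hbar h hβ V r x true

/-- `G̃(r)`, the supremum over `x ∈ C` of the expectation of `r ^ τ` for the split chain started at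
`(x, 0)`, where `τ = inf {n ≥ 1 : X_n ∈ C}`. -/
def Gtilde [IsMarkovKernel P] (h : Minorization P C β ν) (hβ : β < 1) (r : ℝ) : ℝ≥0∞ :=
  ⨆ x ∈ C, genFun (splitKernel h hβ) {p | p.1 ∈ C} r (x, false)

end Split

end

/-! Every expectation in the statement is rewritten as the integral of a potential `∑ n, (1_{Aᶜ} r
κ)^n W`. Such a potential is the least nonnegative supersolution of `Φ = W + 1_{Aᶜ} r κ Φ`, so each
upper bound reduces to exhibiting one explicit supersolution (`potential_le`). The translation from
path space is `sumFun_eq` and `genFun_eq`; the latter uses `r ^ t = 1 + (r - 1) ∑_{n < t} r ^ n`.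

For the split chain, averaging over the label turns the potential up to the first label 1 into a
function `J` on `S` with `J = W + r R J`, where `R = P - β 1_C ν`, and `J` is again least among
measurable supersolutions (`regenPotential_eq`, `regenPotential_le`). From label 1 the next position
has law `ν`, so the regeneration bounds integrate `J` against `ν`; drawing the starting label at
random restores `P`.

Let `u = hitGen`, which equals `r` on `C` and satisfies `u = r P u` off `C`. The drift condition and
Jensen's inequality give `u ≤ r V ^ θ` with `θ = log r / log λ⁻¹`. Hence `∫ V dμ ≤ k` implies `∫ u
dμ ≤ r ^ (1 + log k / log λ⁻¹)`. The residual law on `C` allows `k = (K - β) / (1 - β)`, which gives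
`α₁`, and `ν` allows `k = K / β`, which gives `α₂`.

Put `ρ = r ^ α₁`. On `C`, `R u ≤ (1 - β) ρ < 1`, so summing over the successive visits to `C` that
fail to regenerate is a geometric series: `J ≤ potential W + c u` with `1 - (1 - β) ρ` in the
denominator of `c` (`regenPotential_le_add`). Taking `W = 1` bounds `Ḡ` and `W = V` bounds `H̄`. For
the difference quotient, the increment `F` of `J` between weights 1 and `r` formally solves `F = (r
- 1) R J₁ + r R F`, and a supersolution of that equation is built from `V - 1`, the potential of 1
and `u` (`regenPotential_le_regenPotential_one`).

The bounds at `ν` keep the exact mean `v = ∫ V dν`: it raises the first-excursion term and lowers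
the later ones, and only the combination gives the stated constants. -/

noncomputable section

/-! ### Potentials of killed, weighted chains -/

section Potential

variable {E : Type*} [MeasurableSpace E]

/-- The operator `f ↦ 1_{Aᶜ} · r κ f` of a chain killed on `A` and weighted by `r`. -/
def killedStep (κ : Kernel E E) (A : Set E) (r : ℝ≥0∞) (f : E → ℝ≥0∞) : E → ℝ≥0∞ :=
  Aᶜ.indicator fun x => r * ∫⁻ y, f y ∂κ x

/-- The potential `∑ n, (1_{Aᶜ} r κ)^n W`, i.e. the expectation of `∑ r ^ n W (X_n)` over the times
`n ≥ 0` up to the first visit to `A`. -/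
def potential (κ : Kernel E E) (A : Set E) (r : ℝ≥0∞) (W : E → ℝ≥0∞) (x : E) : ℝ≥0∞ :=
  ∑' n, ((killedStep κ A r)^[n] W) x

variable {κ : Kernel E E} {A : Set E} {r : ℝ≥0∞} {W f : E → ℝ≥0∞}

lemma measurable_killedStep (hA : MeasurableSet A) (hf : Measurable f) :
    Measurable (killedStep κ A r f) :=
  (hf.lintegral_kernel.const_mul r).indicator hA.compl

lemma measurable_iterate_killedStep (hA : MeasurableSet A) (hW : Measurable W) (n : ℕ) :
    Measurable ((killedStep κ A r)^[n] W) := by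
  induction n with
  | zero => exact hW
  | succ n ih =>
    rw [Function.iterate_succ_apply']
    exact measurable_killedStep hA ih

lemma measurable_potential (hA : MeasurableSet A) (hW : Measurable W) :
    Measurable (potential κ A r W) :=
  Measurable.tsum fun n => measurable_iterate_killedStep hA hW n

lemma potential_eq (hA : MeasurableSet A) (hW : Measurable W) (x : E) :
    potential κ A r W x = W x + killedStep κ A r (potential κ A r W) x := by
  have hi : ∀ n, Measurable ((killedStep κ A r)^[n] W) := measurable_iterate_killedStep hA hW
  rw [potential, tsum_eq_zero_add' ENNReal.summable]
  congr 1
  simp only [Function.iterate_succ_apply', killedStep]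
  by_cases hx : x ∈ Aᶜ
  · simp only [Set.indicator_of_mem hx, ENNReal.tsum_mul_left]
    congr 1
    exact (lintegral_tsum fun n => (hi n).aemeasurable).symm
  · simp [Set.indicator_of_notMem hx]

lemma potential_of_mem (hA : MeasurableSet A) (hW : Measurable W) {x : E} (hx : x ∈ A) :
    potential κ A r W x = W x := by
  rw [potential_eq hA hW, killedStep, Set.indicator_of_notMem (by simpa using hx), add_zero]

lemma potential_of_notMem (hA : MeasurableSet A) (hW : Measurable W) {x : E} (hx : x ∉ A) :
    potential κ A r W x = W x + r * ∫⁻ y, potential κ A r W y ∂κ x := by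
  rw [potential_eq hA hW, killedStep, Set.indicator_of_mem (by simpa using hx)]

lemma killedStep_mono {g : E → ℝ≥0∞} (h : f ≤ g) : killedStep κ A r f ≤ killedStep κ A r g :=
  fun _ => Set.indicator_le_indicator (mul_le_mul_right (lintegral_mono h) r)

/-- The potential is the least nonnegative supersolution of `Φ = W + 1_{Aᶜ} r κ Φ`. -/
lemma potential_le (hA : MeasurableSet A) (hW : Measurable W) {Φ : E → ℝ≥0∞}
    (hΦ : ∀ x, W x + killedStep κ A r Φ x ≤ Φ x) : potential κ A r W ≤ Φ := by
  have key : ∀ N : ℕ, (fun x => ∑ n ∈ Finset.range N, ((killedStep κ A r)^[n] W) x) ≤ Φ := by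
    intro N
    induction N with
    | zero => intro x; simp
    | succ N ih =>
      intro x
      refine le_trans (le_of_eq ?_) ((add_le_add_right (killedStep_mono ih x) (W x)).trans (hΦ x))
      simp only
      rw [Finset.sum_range_succ', add_comm]
      congr 1
      simp only [Function.iterate_succ_apply', killedStep]
      by_cases hx : x ∈ Aᶜ
      · simp only [Set.indicator_of_mem hx, ← Finset.mul_sum]
        congr 1
        exact (lintegral_finsetSum _ fun n _ => measurable_iterate_killedStep hA hW n).symm
      · simp [Set.indicator_of_notMem hx]
  intro x
  exact ENNReal.tsum_le_of_sum_range_le fun N => key N x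

end Potential

/-! ### From path-space expectations to potentials -/

section PathSpace

variable {E : Type*} {A : Set E}

/-- The event `n + 1 ≤ τ` is decided by times `1, …, n`, so the Markov property can be applied at
time `n`. Time 0 plays no role, whether or not the start lies in `A`. -/
lemma succ_le_returnTime_iff {n : ℕ} {ω : ℕ → E} :
    ((n + 1 : ℕ) : ℕ∞) ≤ returnTime A ω ↔ ∀ j, 1 ≤ j → j ≤ n → ω j ∉ A := by
  have h := hittingAfter_lt_iff (u := fun n (w : ℕ → E) => w n) (s := A) (n := 1) (i := n + 1)
    (ω := ω)
  rw [← not_lt, returnTime]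
  refine (not_congr h).trans ?_
  simp only [Set.mem_Ico, not_exists, not_and, and_imp, Nat.lt_succ_iff]

/-- The paths up to time `n` which avoid `A` at the times `1, …, n`. -/
def avoidSet (A : Set E) (n : ℕ) : Set ((_ : Finset.Iic n) → E) :=
  {h | ∀ j : Finset.Iic n, 1 ≤ j.1 → h j ∉ A}

lemma frestrictLe_mem_avoidSet_iff {n : ℕ} {ω : ℕ → E} :
    Preorder.frestrictLe (π := fun _ => E) n ω ∈ avoidSet A n ↔
      ((n + 1 : ℕ) : ℕ∞) ≤ returnTime A ω := by
  rw [succ_le_returnTime_iff]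
  simp [avoidSet]
  grind

variable [MeasurableSpace E] {κ : Kernel E E} {f : E → ℝ≥0∞}

lemma measurableSet_avoidSet (hA : MeasurableSet A) (n : ℕ) : MeasurableSet (avoidSet A n) := by
  have : avoidSet A n = ⋂ j : Finset.Iic n, ⋂ _ : 1 ≤ j.1, (fun h => h j) ⁻¹' Aᶜ := by
    ext h; simp [avoidSet]
  rw [this]
  exact MeasurableSet.iInter fun j => MeasurableSet.iInter fun _ =>
    measurable_pi_apply j hA.compl

lemma measurableSet_le_returnTime (hA : MeasurableSet A) (n : ℕ) :
    MeasurableSet {ω : ℕ → E | ((n + 1 : ℕ) : ℕ∞) ≤ returnTime A ω} := by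
  simp only [← frestrictLe_mem_avoidSet_iff]
  exact Preorder.measurable_frestrictLe n (measurableSet_avoidSet hA n)

/-- Markov property at time `n`, with an arbitrary weight `g` depending on the history. -/
lemma lintegral_chainLaw_step [IsMarkovKernel κ] (x : E) (n : ℕ)
    {g : ((_ : Finset.Iic n) → E) → ℝ≥0∞} (hg : Measurable g) (hf : Measurable f) :
    ∫⁻ ω, g (Preorder.frestrictLe (π := fun _ => E) n ω) * f (ω (n + 1)) ∂chainLaw κ x =
      ∫⁻ ω, g (Preorder.frestrictLe (π := fun _ => E) n ω) * ∫⁻ y, f y ∂κ (ω n)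
        ∂chainLaw κ x := by
  have h1 := Kernel.partialTraj_compProd_eq_map_traj (X := fun _ => E) (κ := historyKernel κ)
    (Nat.zero_le n) (x₀ := fun _ => x)
  have h2 := Kernel.traj_map_frestrictLe_apply (X := fun _ => E) (κ := historyKernel κ) 0 n
    (fun _ => x)
  have hm : Measurable fun p : ((_ : Finset.Iic n) → E) × E => g p.1 * f p.2 := by fun_prop
  have h3 : ∫⁻ p, g p.1 * f p.2 ∂((Kernel.traj (X := fun _ => E) (historyKernel κ) 0
      (fun _ => x)).map (fun ω => (Preorder.frestrictLe (π := fun _ => E) n ω, ω (n + 1)))) =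
      ∫⁻ ω, g (Preorder.frestrictLe (π := fun _ => E) n ω) * f (ω (n + 1)) ∂chainLaw κ x :=
    lintegral_map hm (by fun_prop)
  rw [← h3, ← h1, Measure.lintegral_compProd hm, ← h2]
  simp only [lintegral_const_mul _ hf]
  exact lintegral_map (hg.mul hf.lintegral_kernel) (by fun_prop)

-- One Markov step replaces `f` at time `n + 1` by `κ f` at time `n`. When `n ≥ 1`, the event also
-- forces the position at time `n` to avoid `A`, so together with one factor `r` this is
-- `killedStep` applied to `f`, and induction on `n` proceeds with that new function.
open scoped Classical in
lemma lintegral_returnTime_iterate [IsMarkovKernel κ] (hA : MeasurableSet A) (r : ℝ≥0∞) (x : E)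
    (n : ℕ) (hf : Measurable f) :
    ∫⁻ ω, (if ((n + 1 : ℕ) : ℕ∞) ≤ returnTime A ω then r ^ n * f (ω (n + 1)) else 0)
      ∂chainLaw κ x = ∫⁻ y, ((killedStep κ A r)^[n] f) y ∂κ x := by
  have hstep : ∀ (n : ℕ) (f : E → ℝ≥0∞), Measurable f →
      ∫⁻ ω, (if ((n + 1 : ℕ) : ℕ∞) ≤ returnTime A ω then r ^ n * f (ω (n + 1)) else 0)
        ∂chainLaw κ x =
      ∫⁻ ω, (if ((n + 1 : ℕ) : ℕ∞) ≤ returnTime A ω then r ^ n * ∫⁻ y, f y ∂κ (ω n) else 0)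
        ∂chainLaw κ x := by
    intro n f hf
    have hg : Measurable ((avoidSet A n).indicator fun _ => r ^ n) :=
      measurable_const.indicator (measurableSet_avoidSet hA n)
    have := lintegral_chainLaw_step (κ := κ) x n hg hf
    simpa only [Set.indicator_apply, frestrictLe_mem_avoidSet_iff, ite_mul, zero_mul] using this
  induction n generalizing f with
  | zero =>
    rw [hstep 0 f hf]
    have h0 : ∀ ω : ℕ → E, ((0 + 1 : ℕ) : ℕ∞) ≤ returnTime A ω := fun ω =>
      succ_le_returnTime_iff.2 fun j h1 h2 => by omega
    simp only [h0, if_true, pow_zero, one_mul, Function.iterate_zero, id]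
    have h2 := Kernel.traj_map_frestrictLe_apply (X := fun _ => E) (κ := historyKernel κ) 0 0
      (fun _ => x)
    have h3 : ∫⁻ h, ∫⁻ y, f y ∂κ (h ⟨0, by simp⟩) ∂((Kernel.traj (X := fun _ => E)
        (historyKernel κ) 0 (fun _ => x)).map (Preorder.frestrictLe 0)) =
        ∫⁻ ω, ∫⁻ y, f y ∂κ (ω 0) ∂chainLaw κ x :=
      lintegral_map (hf.lintegral_kernel.comp (measurable_pi_apply _)) (by fun_prop)
    rw [← h3, h2, Kernel.partialTraj_self, Kernel.id_apply]
    exact lintegral_dirac' _ (hf.lintegral_kernel.comp (measurable_pi_apply _))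
  | succ n ih =>
    rw [hstep (n + 1) f hf, Function.iterate_succ_apply, ← ih (measurable_killedStep hA hf)]
    congr 1 with ω
    have hiff : ((n + 1 + 1 : ℕ) : ℕ∞) ≤ returnTime A ω ↔
        ((n + 1 : ℕ) : ℕ∞) ≤ returnTime A ω ∧ ω (n + 1) ∉ A := by
      simp only [succ_le_returnTime_iff]
      grind
    by_cases h1 : ((n + 1 : ℕ) : ℕ∞) ≤ returnTime A ω <;> by_cases h2 : ω (n + 1) ∈ A <;>
      simp only [hiff, h1, h2, killedStep, Set.indicator, Set.mem_compl_iff, if_true, if_false,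
        not_true, not_false_eq_true, and_self, and_false, false_and, mul_zero, pow_succ, mul_assoc]

open scoped Classical in
lemma lintegral_tsum_returnTime [IsMarkovKernel κ] (hA : MeasurableSet A) (r : ℝ≥0∞) (x : E)
    (hf : Measurable f) :
    ∫⁻ ω, ∑' n : ℕ, (if ((n + 1 : ℕ) : ℕ∞) ≤ returnTime A ω then r ^ n * f (ω (n + 1)) else 0)
      ∂chainLaw κ x = ∫⁻ y, potential κ A r f y ∂κ x := by
  rw [lintegral_tsum fun n => Measurable.aemeasurable ?_]
  · simp only [lintegral_returnTime_iterate hA r x _ hf, potential]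
    exact (lintegral_tsum fun n => (measurable_iterate_killedStep hA hf n).aemeasurable).symm
  · exact Measurable.ite (measurableSet_le_returnTime hA n)
      ((hf.comp (measurable_pi_apply _)).const_mul _) measurable_const

/-- The sum over times starts at 1 while the potential starts at 0; the shift accounts for the
factor `r` and the integral against `κ x`. -/
lemma sumFun_eq [IsMarkovKernel κ] (hA : MeasurableSet A) {W : E → ℝ} (hW : Measurable W) {r : ℝ}
    (hr : 0 ≤ r) (x : E) :
    sumFun κ A W r x = ENNReal.ofReal r *
      ∫⁻ y, potential κ A (ENNReal.ofReal r) (fun z => ENNReal.ofReal (W z)) y ∂κ x := by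
  classical
  rw [← lintegral_tsum_returnTime hA _ x hW.ennreal_ofReal, sumFun,
    ← lintegral_const_mul' _ _ ENNReal.ofReal_ne_top]
  congr 1 with ω
  rw [tsum_eq_zero_add' ENNReal.summable, ← ENNReal.tsum_mul_left]
  simp only [nonpos_iff_eq_zero, one_ne_zero, false_and, if_false, zero_add,
    Nat.le_add_left, true_and]
  congr 1 with n
  split_ifs with h
  · rw [ENNReal.ofReal_mul (by positivity), ENNReal.ofReal_pow hr, pow_succ']
    ring
  · simp

/-- Finite geometric sum for finite `t`. At `t = ⊤` the series diverges, and the factor `r - 1`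
gives `⊤` for `r > 1` and `0 * ⊤ = 0` for `r = 1`, matching the conventions of `stopPow`. -/
lemma stopPow_eq {r : ℝ} (hr : 1 ≤ r) (t : ℕ∞) :
    stopPow r t = 1 + ENNReal.ofReal (r - 1) *
      ∑' n : ℕ, if ((n + 1 : ℕ) : ℕ∞) ≤ t then ENNReal.ofReal r ^ n else 0 := by
  induction t using ENat.recTopCoe with
  | top =>
    simp only [stopPow, if_true, le_top, not_lt.2 hr, if_false]
    split_ifs with h
    · simp [h]
    · have h1 : 1 < r := lt_of_le_of_ne hr (Ne.symm h)
      have : ∑' n : ℕ, ENNReal.ofReal r ^ n = ⊤ := by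
        rw [ENNReal.tsum_geometric, tsub_eq_zero_of_le (by simpa using hr)]
        simp
      rw [this, ENNReal.mul_top (by simpa using h1)]
      simp
  | coe m =>
    have : ∑' n : ℕ, (if ((n + 1 : ℕ) : ℕ∞) ≤ (m : ℕ∞) then ENNReal.ofReal r ^ n else 0) =
        ∑ n ∈ Finset.range m, ENNReal.ofReal r ^ n := by
      rw [tsum_eq_sum (s := Finset.range m)]
      · refine Finset.sum_congr rfl fun n hn => ?_
        rw [if_pos (by exact_mod_cast Finset.mem_range.1 hn)]
      · intro n hn
        rw [if_neg]
        rw [Finset.mem_range] at hn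
        exact_mod_cast hn
    rw [this, stopPow, if_neg (ENat.natCast_ne_top m), ENat.toNat_natCast]
    simp_rw [← ENNReal.ofReal_pow (zero_le_one.trans hr)]
    rw [← ENNReal.ofReal_sum_of_nonneg (fun i _ => by positivity),
      ← ENNReal.ofReal_mul (by linarith), ← ENNReal.ofReal_one, ← ENNReal.ofReal_add zero_le_one,
      mul_geom_sum]
    · congr 1; ring
    · exact mul_nonneg (by linarith) (Finset.sum_nonneg fun i _ => by positivity)

lemma genFun_eq [IsMarkovKernel κ] (hA : MeasurableSet A) {r : ℝ} (hr : 1 ≤ r) (x : E) :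
    genFun κ A r x = 1 + ENNReal.ofReal (r - 1) *
      ∫⁻ y, potential κ A (ENNReal.ofReal r) (fun _ => 1) y ∂κ x := by
  classical
  have : IsProbabilityMeasure (chainLaw κ x) := by unfold chainLaw; infer_instance
  rw [← lintegral_tsum_returnTime hA _ x measurable_const, genFun,
    ← lintegral_const_mul' _ _ ENNReal.ofReal_ne_top]
  simp only [stopPow_eq hr, mul_one]
  rw [lintegral_add_left measurable_const]
  simp

end PathSpace

/-! ### The split chain with its label averaged out -/

section Regeneration

variable {S : Type*} {C : Set S} {β : ℝ}

lemma labelProb_of_mem {x : S} (hx : x ∈ C) : labelProb C β x = β := by simp [labelProb, hx]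

lemma labelProb_of_notMem {x : S} (hx : x ∉ C) : labelProb C β x = 0 := by simp [labelProb, hx]

lemma labelProb_lt_one (hβ : β < 1) (x : S) : labelProb C β x < 1 := by
  by_cases hx : x ∈ C
  · rwa [labelProb_of_mem hx]
  · rw [labelProb_of_notMem hx]; exact one_pos

variable [MeasurableSpace S] {P : Kernel S S} {ν : Measure S}

lemma labelProb_nonneg (h : Minorization P C β ν) (x : S) : 0 ≤ labelProb C β x :=
  Set.indicator_nonneg (fun _ _ => h.pos.le) x

lemma ofReal_labelProb_add (h : Minorization P C β ν) (hβ : β < 1) (x : S) :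
    ENNReal.ofReal (labelProb C β x) + ENNReal.ofReal (1 - labelProb C β x) = 1 := by
  rw [← ENNReal.ofReal_add (labelProb_nonneg h x) (by linarith [labelProb_lt_one (C := C) hβ x])]
  simp

lemma lintegral_labelKernel (h : Minorization P C β ν) {f : S × Bool → ℝ≥0∞} (hf : Measurable f)
    (x : S) : ∫⁻ p, f p ∂labelKernel h x = ENNReal.ofReal (labelProb C β x) * f (x, true) +
      ENNReal.ofReal (1 - labelProb C β x) * f (x, false) := by
  change ∫⁻ p, f p ∂(ENNReal.ofReal (labelProb C β x) • Measure.dirac (x, true) +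
    ENNReal.ofReal (1 - labelProb C β x) • Measure.dirac (x, false)) = _
  simp [lintegral_add_measure, lintegral_smul_measure, lintegral_dirac' _ hf]

lemma lintegral_splitKernel [IsMarkovKernel P] (h : Minorization P C β ν) (hβ : β < 1)
    {f : S × Bool → ℝ≥0∞} (hf : Measurable f) (p : S × Bool) :
    ∫⁻ q, f q ∂splitKernel h hβ p = ∫⁻ y, (ENNReal.ofReal (labelProb C β y) * f (y, true) +
      ENNReal.ofReal (1 - labelProb C β y) * f (y, false)) ∂stepMeasure P C β ν p := by
  rw [splitKernel, Kernel.lintegral_comp _ _ _ hf]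
  simp only [lintegral_labelKernel h hf]
  rfl

lemma stepMeasure_true (x : S) : stepMeasure P C β ν (x, true) = ν := by simp [stepMeasure]

lemma stepMeasure_false_of_notMem {x : S} (hx : x ∉ C) :
    stepMeasure P C β ν (x, false) = P x := by simp [stepMeasure, hx]

lemma isProbabilityMeasure_stepMeasure [IsMarkovKernel P] (h : Minorization P C β ν) (hβ : β < 1)
    (p : S × Bool) : IsProbabilityMeasure (stepMeasure P C β ν p) :=
  (isMarkovKernel_stepKernel h hβ).isProbabilityMeasure p

/-- The substochastic operator `f ↦ P f - β 1_C ν(f)`. -/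
def residualOp (P : Kernel S S) (C : Set S) (β : ℝ) (ν : Measure S) (f : S → ℝ≥0∞) (x : S) : ℝ≥0∞ :=
  ENNReal.ofReal (1 - labelProb C β x) * ∫⁻ y, f y ∂stepMeasure P C β ν (x, false)

lemma residualOp_mono {f g : S → ℝ≥0∞} (hfg : f ≤ g) : residualOp P C β ν f ≤ residualOp P C β ν g :=
  fun _ => mul_le_mul_right (lintegral_mono hfg) _

lemma residualOp_add {f g : S → ℝ≥0∞} (hf : Measurable f) (x : S) :
    residualOp P C β ν (fun y => f y + g y) x = residualOp P C β ν f x + residualOp P C β ν g x := by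
  rw [residualOp, lintegral_add_left hf, mul_add]; rfl

lemma residualOp_const_mul {f : S → ℝ≥0∞} {c : ℝ≥0∞} (hf : Measurable f) (x : S) :
    residualOp P C β ν (fun y => c * f y) x = c * residualOp P C β ν f x := by
  rw [residualOp, lintegral_const_mul _ hf, mul_left_comm]; rfl

lemma residualOp_const [IsMarkovKernel P] (h : Minorization P C β ν) (hβ : β < 1) (c : ℝ≥0∞) (x : S) :
    residualOp P C β ν (fun _ => c) x = ENNReal.ofReal (1 - labelProb C β x) * c := by
  have := isProbabilityMeasure_stepMeasure h hβ (x, false)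
  simp [residualOp]

lemma residualOp_of_notMem {f : S → ℝ≥0∞} {x : S} (hx : x ∉ C) :
    residualOp P C β ν f x = ∫⁻ y, f y ∂P x := by
  simp [residualOp, labelProb_of_notMem hx, stepMeasure_false_of_notMem hx]

lemma residualOp_of_mem {f : S → ℝ≥0∞} {x : S} (hx : x ∈ C) :
    residualOp P C β ν f x = ENNReal.ofReal (1 - β) * ∫⁻ y, f y ∂stepMeasure P C β ν (x, false) := by
  rw [residualOp, labelProb_of_mem hx]

/-- The normalisation `1 - β` of the residual law cancels on `C`. Stating `R f + β 1_C ν(f) = P f`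
additively avoids subtraction in `ℝ≥0∞`. -/
lemma residualOp_add_lintegral [IsMarkovKernel P] (h : Minorization P C β ν) (hβ : β < 1)
    (f : S → ℝ≥0∞) (x : S) :
    residualOp P C β ν f x + ENNReal.ofReal (labelProb C β x) * ∫⁻ y, f y ∂ν = ∫⁻ y, f y ∂P x := by
  by_cases hx : x ∈ C
  · have := h.isProbabilityMeasure
    have : IsFiniteMeasure (ENNReal.ofReal β • ν) := Measure.smul_finite ν ENNReal.ofReal_ne_top
    have hs : stepMeasure P C β ν (x, false) =
        (ENNReal.ofReal (1 - β))⁻¹ • (P x - ENNReal.ofReal β • ν) := by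
      simp [stepMeasure, hx]
    have h1 : ENNReal.ofReal (1 - β) ≠ 0 := by simpa using hβ
    rw [residualOp_of_mem hx, hs, labelProb_of_mem hx, lintegral_smul_measure, smul_eq_mul,
      ← mul_assoc, ENNReal.mul_inv_cancel h1 ENNReal.ofReal_ne_top, one_mul, ← smul_eq_mul,
      ← lintegral_smul_measure, ← lintegral_add_measure, Measure.sub_add_cancel_of_le (h.smul_le hx)]
  · rw [residualOp_of_notMem hx, labelProb_of_notMem hx]; simp

/-- The mean of the split-chain potential up to the first label `1`, when the position is `x` and
its label is drawn at random. -/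
def regenPotential [IsMarkovKernel P] (h : Minorization P C β ν) (hβ : β < 1) (r : ℝ≥0∞)
    (W : S → ℝ≥0∞) (x : S) : ℝ≥0∞ :=
  ENNReal.ofReal (labelProb C β x) *
      potential (splitKernel h hβ) {p | p.2 = true} r (fun p => W p.1) (x, true) +
    ENNReal.ofReal (1 - labelProb C β x) *
      potential (splitKernel h hβ) {p | p.2 = true} r (fun p => W p.1) (x, false)

variable [IsMarkovKernel P] {h : Minorization P C β ν} {hβ : β < 1} {r : ℝ≥0∞} {W : S → ℝ≥0∞}

lemma measurableSet_label : MeasurableSet {p : S × Bool | p.2 = true} :=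
  measurable_snd (measurableSet_singleton true)

lemma measurable_splitPotential (hW : Measurable W) :
    Measurable (potential (splitKernel h hβ) {p | p.2 = true} r (fun p => W p.1)) :=
  measurable_potential measurableSet_label (hW.comp measurable_fst)

lemma measurable_regenPotential (hW : Measurable W) : Measurable (regenPotential h hβ r W) := by
  have hl := measurable_labelProb h
  have hm := measurable_splitPotential (h := h) (hβ := hβ) (r := r) hW
  exact (hl.ennreal_ofReal.mul (hm.comp (by fun_prop))).add
    ((hl.const_sub 1).ennreal_ofReal.mul (hm.comp (by fun_prop)))

lemma lintegral_splitPotential (hW : Measurable W) (p : S × Bool) :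
    ∫⁻ q, potential (splitKernel h hβ) {p | p.2 = true} r (fun p => W p.1) q ∂splitKernel h hβ p =
      ∫⁻ y, regenPotential h hβ r W y ∂stepMeasure P C β ν p :=
  lintegral_splitKernel h hβ (measurable_splitPotential hW) p

/-- Label 1 stops the sum after `W x`; label 0 adds a further step from the residual law. The two
label weights add up to 1 in front of `W x`. -/
lemma regenPotential_eq (hW : Measurable W) (x : S) :
    regenPotential h hβ r W x = W x + r * residualOp P C β ν (regenPotential h hβ r W) x := by
  have hW' : Measurable fun p : S × Bool => W p.1 := hW.comp measurable_fst
  conv_lhs => rw [regenPotential]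
  rw [potential_of_mem measurableSet_label hW' (show (x, true) ∈ {p : S × Bool | p.2 = true} from rfl),
    potential_of_notMem measurableSet_label hW'
      (show (x, false) ∉ {p : S × Bool | p.2 = true} by simp),
    lintegral_splitPotential hW, mul_add, ← add_assoc, ← add_mul, ofReal_labelProb_add h hβ, one_mul,
    mul_left_comm, residualOp]

/-- The regeneration potential is the least measurable supersolution of `Φ = W + r (P - β 1_C ν) Φ`. -/
lemma regenPotential_le (hW : Measurable W) {Φ : S → ℝ≥0∞} (hΦm : Measurable Φ)
    (hΦ : ∀ x, W x + r * residualOp P C β ν Φ x ≤ Φ x) : regenPotential h hβ r W ≤ Φ := by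
  have hW' : Measurable fun p : S × Bool => W p.1 := hW.comp measurable_fst
  -- Lift of `Φ` to the split space: the label-0 value takes one step into `Φ`. Its label average is
  -- `W + r R Φ ≤ Φ`, which makes `Ψ` a supersolution for the split chain.
  set Ψ : S × Bool → ℝ≥0∞ := fun p => W p.1 +
    {p : S × Bool | p.2 = true}ᶜ.indicator (fun p => r * ∫⁻ y, Φ y ∂stepKernel h p) p with hΨ
  have hΨm : Measurable Ψ :=
    hW'.add ((hΦm.lintegral_kernel.const_mul r).indicator measurableSet_label.compl)
  have ht : ∀ y, Ψ (y, true) = W y := fun y => by simp [hΨ]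
  have hf : ∀ y, Ψ (y, false) = W y + r * ∫⁻ z, Φ z ∂stepMeasure P C β ν (y, false) := fun y => by
    simp only [hΨ]
    rw [Set.indicator_of_mem (by simp)]
    rfl
  have hmix : ∀ y, ENNReal.ofReal (labelProb C β y) * Ψ (y, true) +
      ENNReal.ofReal (1 - labelProb C β y) * Ψ (y, false) ≤ Φ y := fun y => by
    rw [ht, hf, mul_add, ← add_assoc, ← add_mul, ofReal_labelProb_add h hβ, one_mul, mul_left_comm]
    exact hΦ y
  have hle : potential (splitKernel h hβ) {p | p.2 = true} r (fun p => W p.1) ≤ Ψ := by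
    refine potential_le measurableSet_label hW' fun p => ?_
    have hp : ∫⁻ q, Ψ q ∂splitKernel h hβ p ≤ ∫⁻ y, Φ y ∂stepKernel h p := by
      rw [lintegral_splitKernel h hβ hΨm]
      exact lintegral_mono hmix
    refine add_le_add_right ?_ (W p.1)
    exact Set.indicator_le_indicator (f := fun p => r * ∫⁻ q, Ψ q ∂splitKernel h hβ p)
      (g := fun p => r * ∫⁻ y, Φ y ∂stepKernel h p) (mul_le_mul_right hp r)
  intro y
  exact le_trans (add_le_add (mul_le_mul_right (hle _) _) (mul_le_mul_right (hle _) _)) (hmix y)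

lemma Hbar_eq {V : S → ℝ} (hV : Measurable V) {s : ℝ} (hs : 0 ≤ s) (x : S) (i : Bool) :
    Hbar h hβ V s x i = ENNReal.ofReal s *
      ∫⁻ y, regenPotential h hβ (ENNReal.ofReal s) (fun z => ENNReal.ofReal (V z)) y
        ∂stepMeasure P C β ν (x, i) := by
  rw [Hbar, sumFun_eq (W := fun p => V p.1) measurableSet_label (hV.comp measurable_fst) hs]
  congr 1
  exact lintegral_splitPotential hV.ennreal_ofReal _

lemma Gbar_eq {s : ℝ} (hs : 1 ≤ s) (x : S) (i : Bool) :
    Gbar h hβ s x i = 1 + ENNReal.ofReal (s - 1) *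
      ∫⁻ y, regenPotential h hβ (ENNReal.ofReal s) (fun _ => 1) y ∂stepMeasure P C β ν (x, i) := by
  rw [Gbar, genFun_eq measurableSet_label hs]
  congr 2
  exact lintegral_splitPotential measurable_const _

/-- Mixing the laws of the next position over the starting label gives back `P x`. -/
lemma HbarMix_eq {V : S → ℝ} (hV : Measurable V) {s : ℝ} (hs : 0 ≤ s) (x : S) :
    HbarMix h hβ V s x = ENNReal.ofReal s *
      ∫⁻ y, regenPotential h hβ (ENNReal.ofReal s) (fun z => ENNReal.ofReal (V z)) y ∂P x := by
  rw [HbarMix, Hbar_eq hV hs, Hbar_eq hV hs, stepMeasure_true, ← residualOp_add_lintegral h hβ,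
    residualOp, mul_add]
  ring

lemma GbarMix_eq {s : ℝ} (hs : 1 ≤ s) (x : S) :
    GbarMix h hβ s x = 1 + ENNReal.ofReal (s - 1) *
      ∫⁻ y, regenPotential h hβ (ENNReal.ofReal s) (fun _ => 1) y ∂P x := by
  rw [GbarMix, Gbar_eq hs, Gbar_eq hs, stepMeasure_true, ← residualOp_add_lintegral h hβ,
    residualOp]
  conv_rhs => enter [1]; rw [← ofReal_labelProb_add h hβ x]
  ring

end Regeneration

/-! ### Moments under a probability measure -/

section MomentBounds

variable {S : Type*} [MeasurableSpace S] {μ : Measure S} [IsProbabilityMeasure μ] {f : S → ℝ} {k : ℝ}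

/-- Pointwise nonnegativity of the affine function keeps `ENNReal.ofReal` from truncating, so `b`
can be moved across and integrated exactly. -/
lemma lintegral_ofReal_affine_le {a b : ℝ} (ha : 0 ≤ a) (hb : 0 ≤ b)
    (hab : ∀ x, b ≤ a * f x) (hk : ∫⁻ x, ENNReal.ofReal (f x) ∂μ ≤ ENNReal.ofReal k) :
    ∫⁻ x, ENNReal.ofReal (a * f x - b) ∂μ ≤ ENNReal.ofReal (a * k - b) := by
  have h1 : ∫⁻ x, ENNReal.ofReal (a * f x - b) ∂μ + ENNReal.ofReal b =
      ENNReal.ofReal a * ∫⁻ x, ENNReal.ofReal (f x) ∂μ := by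
    rw [← lintegral_const_mul' _ _ ENNReal.ofReal_ne_top]
    have : ENNReal.ofReal b = ∫⁻ _, ENNReal.ofReal b ∂μ := by simp
    rw [this, ← lintegral_add_right _ measurable_const]
    congr 1 with x
    rw [← ENNReal.ofReal_add (by linarith [hab x]) hb, ← ENNReal.ofReal_mul ha]
    congr 1; ring
  rw [ENNReal.ofReal_sub _ hb, ENNReal.ofReal_mul ha]
  refine ENNReal.le_sub_of_add_le_right ENNReal.ofReal_ne_top ?_
  rw [h1]
  gcongr

lemma one_le_of_lintegral_ofReal_le (h1 : ∀ x, 1 ≤ f x)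
    (hk : ∫⁻ x, ENNReal.ofReal (f x) ∂μ ≤ ENNReal.ofReal k) : 1 ≤ k := by
  have : ∫⁻ _, 1 ∂μ ≤ ∫⁻ x, ENNReal.ofReal (f x) ∂μ :=
    lintegral_mono fun x => ENNReal.one_le_ofReal.2 (h1 x)
  rw [lintegral_one, measure_univ] at this
  exact ENNReal.one_le_ofReal.1 (this.trans hk)

/-- Jensen's inequality for a concave power, read off from monotonicity of `L^p` norms on a
probability space. -/
lemma lintegral_rpow_le_rpow_lintegral {g : S → ℝ≥0∞} (hg : Measurable g) {θ : ℝ} (h0 : 0 ≤ θ)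
    (h1 : θ ≤ 1) : ∫⁻ x, g x ^ θ ∂μ ≤ (∫⁻ x, g x ∂μ) ^ θ := by
  rcases h0.eq_or_lt with rfl | h0
  · simp
  have h := eLpNorm'_le_eLpNorm'_of_exponent_le h0 h1 μ hg.aestronglyMeasurable
  simp only [eLpNorm', enorm_eq_self, ENNReal.rpow_one, ne_eq, one_ne_zero, not_false_eq_true,
    div_self] at h
  have h2 := ENNReal.rpow_le_rpow h h0.le
  rwa [← ENNReal.rpow_mul, one_div, inv_mul_cancel₀ h0.ne', ENNReal.rpow_one] at h2

lemma lintegral_ofReal_rpow_le (hf : Measurable f) (h1 : ∀ x, 1 ≤ f x) {θ : ℝ} (hθ : 0 ≤ θ)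
    (hθ1 : θ ≤ 1) (hk : ∫⁻ x, ENNReal.ofReal (f x) ∂μ ≤ ENNReal.ofReal k) :
    ∫⁻ x, ENNReal.ofReal (f x ^ θ) ∂μ ≤ ENNReal.ofReal (k ^ θ) := by
  have hk1 := one_le_of_lintegral_ofReal_le h1 hk
  rw [← ENNReal.ofReal_rpow_of_nonneg (by linarith) hθ]
  refine le_trans (le_of_eq ?_) ((lintegral_rpow_le_rpow_lintegral hf.ennreal_ofReal hθ hθ1).trans
    (ENNReal.rpow_le_rpow hk hθ))
  congr 1 with x
  rw [ENNReal.ofReal_rpow_of_nonneg (by linarith [h1 x]) hθ]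

end MomentBounds

/-! ### First visit to `C` under the drift condition -/

section Visits

variable {S : Type*} [MeasurableSpace S] {P : Kernel S S} {C : Set S}

/-- `r` times the expectation of `r ^ σ`, where `σ = inf {n ≥ 0 : X_n ∈ C}`. -/
def hitGen (P : Kernel S S) (C : Set S) (r : ℝ) (x : S) : ℝ≥0∞ :=
  1 + ENNReal.ofReal (r - 1) * potential P C (ENNReal.ofReal r) (fun _ => 1) x

lemma measurable_hitGen (hC : MeasurableSet C) (r : ℝ) : Measurable (hitGen P C r) :=
  ((measurable_potential hC measurable_const).const_mul _).const_add _

lemma ofReal_one_add_sub {r : ℝ} (hr : 1 ≤ r) : 1 + ENNReal.ofReal (r - 1) = ENNReal.ofReal r := by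
  rw [← ENNReal.ofReal_one, ← ENNReal.ofReal_add zero_le_one (by linarith)]
  congr 1; ring

lemma hitGen_of_mem (hC : MeasurableSet C) {r : ℝ} (hr : 1 ≤ r) {x : S} (hx : x ∈ C) :
    hitGen P C r x = ENNReal.ofReal r := by
  rw [hitGen, potential_of_mem hC measurable_const hx, mul_one, ofReal_one_add_sub hr]

lemma lintegral_hitGen (hC : MeasurableSet C) (r : ℝ) (μ : Measure S) [IsProbabilityMeasure μ] :
    ∫⁻ y, hitGen P C r y ∂μ = 1 + ENNReal.ofReal (r - 1) *
      ∫⁻ y, potential P C (ENNReal.ofReal r) (fun _ => 1) y ∂μ := by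
  simp only [hitGen]
  rw [lintegral_add_left measurable_const,
    lintegral_const_mul _ (measurable_potential hC measurable_const)]
  simp

lemma hitGen_of_notMem [IsMarkovKernel P] (hC : MeasurableSet C) {r : ℝ} (hr : 1 ≤ r) {x : S}
    (hx : x ∉ C) : hitGen P C r x = ENNReal.ofReal r * ∫⁻ y, hitGen P C r y ∂P x := by
  rw [lintegral_hitGen hC, hitGen, potential_of_notMem hC measurable_const hx, mul_add, mul_add,
    mul_one, mul_one, ← add_assoc, ofReal_one_add_sub hr, mul_left_comm]

lemma Gorig_eq [IsMarkovKernel P] (hC : MeasurableSet C) {r : ℝ} (hr : 1 ≤ r) (x : S) :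
    Gorig P C r x = ∫⁻ y, hitGen P C r y ∂P x := by
  rw [Gorig, genFun_eq hC hr, lintegral_hitGen hC]

lemma hitGen_one (x : S) : hitGen P C 1 x = 1 := by simp [hitGen]

variable {V : S → ℝ} {lam K : ℝ}

/-- By Jensen, `P (V ^ θ) ≤ λ ^ θ V ^ θ` off `C`, so `V ^ θ` contracts at least as fast as the
weight `r` grows. -/
lemma hitGen_le [IsMarkovKernel P] (hC : MeasurableSet C) (hV : Drift P C V lam K) (hlam : 0 < lam)
    {r θ : ℝ} (hr : 1 ≤ r) (hθ : 0 ≤ θ) (hθ1 : θ ≤ 1) (hrθ : r * lam ^ θ ≤ 1) (x : S) :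
    hitGen P C r x ≤ ENNReal.ofReal (r * V x ^ θ) := by
  have hV1 : ∀ x, 1 ≤ V x ^ θ := fun x => Real.one_le_rpow (hV.one_le x) hθ
  rcases hr.eq_or_lt with rfl | hr
  · simpa [hitGen] using hV1 x
  have h1 : 0 < r - 1 := by linarith
  -- The supersolution is found by solving `1 + (r - 1) Φ = r V ^ θ` for `Φ`, whence the separate
  -- treatment of `r = 1`.
  have hle : potential P C (ENNReal.ofReal r) (fun _ => 1) ≤
      fun x => ENNReal.ofReal (r / (r - 1) * V x ^ θ - 1 / (r - 1)) := by
    have hb : ∀ x, 1 / (r - 1) ≤ r / (r - 1) * V x ^ θ := fun x => by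
      rw [div_mul_eq_mul_div, div_le_div_iff_of_pos_right h1]
      nlinarith [hV1 x]
    refine potential_le hC measurable_const fun x => ?_
    by_cases hx : x ∈ C
    · rw [killedStep, Set.indicator_of_notMem (by simpa using hx), add_zero, ENNReal.one_le_ofReal,
        div_mul_eq_mul_div, ← sub_div, le_div_iff₀ h1]
      nlinarith [hV1 x]
    · rw [killedStep, Set.indicator_of_mem (by simpa using hx)]
      have hm := lintegral_ofReal_affine_le (by positivity)
        (by positivity) hb
        (lintegral_ofReal_rpow_le hV.measurable hV.one_le hθ hθ1 (hV.of_notMem x hx))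
      have hk := one_le_of_lintegral_ofReal_le hV.one_le (hV.of_notMem x hx)
      have hk1 := Real.one_le_rpow hk hθ
      refine (add_le_add_right (mul_le_mul_right hm _) 1).trans ?_
      have h0 : 0 ≤ r / (r - 1) * (lam * V x) ^ θ - 1 / (r - 1) := by
        rw [div_mul_eq_mul_div, ← sub_div]
        exact div_nonneg (by nlinarith) h1.le
      rw [← ENNReal.ofReal_mul (by linarith), ← ENNReal.ofReal_one,
        ← ENNReal.ofReal_add zero_le_one (mul_nonneg (by linarith) h0)]
      refine ENNReal.ofReal_le_ofReal ?_
      rw [Real.mul_rpow hlam.le (by linarith [hV.one_le x])]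
      have h2 : r * (lam ^ θ * V x ^ θ) ≤ V x ^ θ := by nlinarith [hV1 x]
      rw [div_mul_eq_mul_div, div_mul_eq_mul_div, ← sub_div, ← sub_div, ← mul_div_assoc,
        ← sub_nonneg]
      have : (r * V x ^ θ - 1) / (r - 1) - (1 + r * (r * (lam ^ θ * V x ^ θ) - 1) / (r - 1)) =
          r * (V x ^ θ - r * (lam ^ θ * V x ^ θ)) / (r - 1) := by field_simp; ring
      rw [this]
      exact div_nonneg (mul_nonneg (by linarith) (by linarith)) h1.le
  have h0 : 0 ≤ r / (r - 1) * V x ^ θ - 1 / (r - 1) := by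
    rw [div_mul_eq_mul_div, ← sub_div]
    exact div_nonneg (by nlinarith [hV1 x]) h1.le
  refine (add_le_add_right (mul_le_mul_right (hle x) _) 1).trans (le_of_eq ?_)
  rw [← ENNReal.ofReal_mul h1.le, ← ENNReal.ofReal_one, ← ENNReal.ofReal_add zero_le_one
    (mul_nonneg h1.le h0)]
  congr 1
  field_simp
  ring

/-- The supersolution is `(V - rλ) / (1 - rλ)`. On `C` it dominates `V` exactly because `V ≥ 1`; off
`C` the drift leaves a slack `rλ(r - 1) / (1 - rλ)`. -/
lemma potential_drift_le [IsMarkovKernel P] (hC : MeasurableSet C) (hV : Drift P C V lam K)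
    (hlam : 0 < lam) {r : ℝ} (hr : 1 ≤ r) (hrl : r * lam < 1) (x : S) :
    potential P C (ENNReal.ofReal r) (fun z => ENNReal.ofReal (V z)) x ≤
      ENNReal.ofReal (1 / (1 - r * lam) * V x - r * lam / (1 - r * lam)) := by
  have h1 : 0 < 1 - r * lam := by linarith
  have h2 : 0 < r * lam := by positivity
  have hb : ∀ x, r * lam / (1 - r * lam) ≤ 1 / (1 - r * lam) * V x := fun x => by
    rw [div_mul_eq_mul_div, div_le_div_iff_of_pos_right h1]
    linarith [hV.one_le x]
  refine potential_le (Φ := fun x => ENNReal.ofReal (1 / (1 - r * lam) * V x -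
    r * lam / (1 - r * lam))) hC hV.measurable.ennreal_ofReal (fun x => ?_) x
  by_cases hx : x ∈ C
  · rw [killedStep, Set.indicator_of_notMem (by simpa using hx), add_zero]
    refine ENNReal.ofReal_le_ofReal ?_
    rw [div_mul_eq_mul_div, ← sub_div, le_div_iff₀ h1]
    nlinarith [hV.one_le x]
  · rw [killedStep, Set.indicator_of_mem (by simpa using hx)]
    have hm := lintegral_ofReal_affine_le (by positivity)
      (by positivity) hb (hV.of_notMem x hx)
    have hk := one_le_of_lintegral_ofReal_le hV.one_le (hV.of_notMem x hx)
    refine (add_le_add_right (mul_le_mul_right hm _) _).trans ?_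
    have h0 : 0 ≤ 1 / (1 - r * lam) * (lam * V x) - r * lam / (1 - r * lam) := by
      rw [div_mul_eq_mul_div, ← sub_div]
      exact div_nonneg (by linarith) h1.le
    rw [← ENNReal.ofReal_mul (by linarith), ← ENNReal.ofReal_add (by linarith [hV.one_le x])
      (mul_nonneg (by linarith) h0)]
    refine ENNReal.ofReal_le_ofReal ?_
    rw [← sub_nonneg]
    have : 1 / (1 - r * lam) * V x - r * lam / (1 - r * lam) -
        (V x + r * (1 / (1 - r * lam) * (lam * V x) - r * lam / (1 - r * lam))) =
        r * lam * (r - 1) / (1 - r * lam) := by field_simp; ring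
    rw [this]
    exact div_nonneg (mul_nonneg h2.le (by linarith)) h1.le

lemma exists_lintegral_drift_le (hV : Drift P C V lam K) (x : S) :
    ∃ k : ℝ, ∫⁻ y, ENNReal.ofReal (V y) ∂P x ≤ ENNReal.ofReal k := by
  by_cases hx : x ∈ C
  · exact ⟨_, hV.of_mem x hx⟩
  · exact ⟨_, hV.of_notMem x hx⟩

end Visits

/-! ### Exponents and powers of `r` -/

section Exponents

/-- The exponent `log r / log λ⁻¹` interpolating between `r = 1` and `r = λ⁻¹`. -/
lemma exponent_mem {lam r : ℝ} (hlam : 0 < lam) (hlam1 : lam < 1) (hr : 1 ≤ r) (hr' : r ≤ lam⁻¹) :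
    0 ≤ Real.log r / Real.log lam⁻¹ ∧ Real.log r / Real.log lam⁻¹ ≤ 1 := by
  have hl : 0 < Real.log lam⁻¹ := Real.log_pos (by rw [one_lt_inv₀ hlam]; exact hlam1)
  refine ⟨div_nonneg (Real.log_nonneg hr) hl.le, ?_⟩
  rw [div_le_one hl]
  exact Real.log_le_log (by linarith) hr'

lemma mul_rpow_exponent_eq_one {lam r : ℝ} (hlam : 0 < lam) (hlam1 : lam < 1) (hr : 0 < r) :
    r * lam ^ (Real.log r / Real.log lam⁻¹) = 1 := by
  have hl : Real.log lam ≠ 0 := (Real.log_neg hlam hlam1).ne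
  rw [Real.rpow_def_of_pos hlam, Real.log_inv,
    show Real.log lam * (Real.log r / -Real.log lam) = -Real.log r by field_simp, Real.exp_neg,
    Real.exp_log hr]
  exact mul_inv_cancel₀ hr.ne'

/-- The symmetry `k ^ (log r) = r ^ (log k)` turns the moment bound `r k ^ θ` into a power of `r`;
this is the form of `α₁` and `α₂`. -/
lemma mul_rpow_exponent {lam r k : ℝ} (hr : 0 < r) (hk : 0 < k) :
    r * k ^ (Real.log r / Real.log lam⁻¹) = r ^ (1 + Real.log k / Real.log lam⁻¹) := by
  rw [Real.rpow_add hr, Real.rpow_one, Real.rpow_def_of_pos hr, Real.rpow_def_of_pos hk]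
  congr 2
  ring

end Exponents

/-! ### Split chain compared with the original chain -/

section SplitBounds

variable {S : Type*} [MeasurableSpace S] {P : Kernel S S} [IsMarkovKernel P] {C : Set S} {β : ℝ}
  {ν : Measure S} {V : S → ℝ} {lam K : ℝ}

/-- Until it hits `C` the split chain moves like the original chain. -/
lemma genFun_splitKernel_le (h : Minorization P C β ν) (hβ : β < 1) {r : ℝ} (hr : 1 ≤ r)
    (p : S × Bool) :
    genFun (splitKernel h hβ) {p | p.1 ∈ C} r p ≤ ∫⁻ y, hitGen P C r y ∂stepMeasure P C β ν p := by
  classical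
  have hC := h.measurableSet
  have hCS : MeasurableSet {p : S × Bool | p.1 ∈ C} := measurable_fst hC
  set m := potential P C (ENNReal.ofReal r) (fun _ => 1) with hm
  have hmm : Measurable m := measurable_potential hC measurable_const
  -- States with label 1 outside `C` are reached with probability 0. The value `⊤` makes the
  -- supersolution inequality trivial there and disappears from integrals because `0 * ⊤ = 0`.
  set Φ : S × Bool → ℝ≥0∞ := fun p => if p.2 = true ∧ p.1 ∉ C then ⊤ else m p.1 with hΦ
  have hΦm : Measurable Φ :=
    Measurable.ite (measurableSet_label.inter (measurable_fst hC.compl)) measurable_const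
      (hmm.comp measurable_fst)
  have hint : ∀ p, ∫⁻ q, Φ q ∂splitKernel h hβ p = ∫⁻ y, m y ∂stepMeasure P C β ν p := by
    intro p
    rw [lintegral_splitKernel h hβ hΦm]
    congr 1 with y
    by_cases hy : y ∈ C
    · simp only [hΦ, hy, not_true, and_false, if_false]
      rw [← add_mul, ofReal_labelProb_add h hβ, one_mul]
    · simp [hΦ, labelProb_of_notMem hy]
  have hle : potential (splitKernel h hβ) {p | p.1 ∈ C} (ENNReal.ofReal r) (fun _ => 1) ≤ Φ := by
    refine potential_le hCS measurable_const ?_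
    rintro ⟨y, i⟩
    by_cases hy : y ∈ C
    · rw [killedStep, Set.indicator_of_notMem (by simpa using hy), add_zero]
      simp only [hΦ, hy, not_true, and_false, if_false]
      rw [hm, potential_of_mem hC measurable_const hy]
    · cases i
      · rw [killedStep, Set.indicator_of_mem (by simpa using hy), hint,
          stepMeasure_false_of_notMem hy]
        simp only [hΦ, Bool.false_eq_true, false_and, if_false]
        rw [hm, potential_of_notMem hC measurable_const hy]
      · simp [hΦ, hy]
  have := isProbabilityMeasure_stepMeasure h hβ p
  rw [genFun_eq hCS hr, lintegral_hitGen hC, ← hint]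
  gcongr
  exact hle _

lemma Minorization.lintegral_le (h : Minorization P C β ν) (hβ : β < 1) (hV : Drift P C V lam K)
    {x : S} (hx : x ∈ C) : ENNReal.ofReal β * ∫⁻ y, ENNReal.ofReal (V y) ∂ν ≤ ENNReal.ofReal K := by
  refine le_trans ?_ (hV.of_mem x hx)
  rw [← residualOp_add_lintegral h hβ _ x, labelProb_of_mem hx]
  exact le_add_self

/-- Minorization at a point of `C` gives `β ν(V) ≤ P V ≤ K`, so the `ν`-mean of `V` is a finite
real. -/
lemma Minorization.exists_mean (h : Minorization P C β ν) (hβ : β < 1) (hV : Drift P C V lam K)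
    {a : S} (ha : a ∈ C) : ∃ v : ℝ, 1 ≤ v ∧ β * v ≤ K ∧
      ∫⁻ y, ENNReal.ofReal (V y) ∂ν = ENNReal.ofReal v := by
  have hν := h.isProbabilityMeasure
  have hle := h.lintegral_le hβ hV ha
  have hβ0 := h.pos
  have hfin : ∫⁻ y, ENNReal.ofReal (V y) ∂ν ≠ ⊤ := fun ht => by
    rw [ht, ENNReal.mul_top (by simpa using hβ0)] at hle
    exact absurd hle (by simp)
  have heq := (ENNReal.ofReal_toReal hfin).symm
  have h1 := one_le_of_lintegral_ofReal_le hV.one_le heq.le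
  refine ⟨_, h1, ?_, heq⟩
  rw [heq, ← ENNReal.ofReal_mul hβ0.le] at hle
  have : 0 < β * (∫⁻ y, ENNReal.ofReal (V y) ∂ν).toReal := by positivity
  rcases ENNReal.ofReal_le_ofReal_iff'.1 hle with h2 | h2
  · exact h2
  · linarith

lemma Minorization.lintegral_stepMeasure_le (h : Minorization P C β ν) (hβ : β < 1)
    (hV : Drift P C V lam K) {v : ℝ} (hv : 0 ≤ v)
    (hνv : ∫⁻ y, ENNReal.ofReal (V y) ∂ν = ENNReal.ofReal v) {x : S} (hx : x ∈ C) :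
    ∫⁻ y, ENNReal.ofReal (V y) ∂stepMeasure P C β ν (x, false) ≤
      ENNReal.ofReal ((K - β * v) / (1 - β)) := by
  have hβ' : 0 < 1 - β := by linarith
  have hR := residualOp_add_lintegral h hβ (fun y => ENNReal.ofReal (V y)) x
  have hle := hV.of_mem x hx
  rw [← hR, labelProb_of_mem hx, residualOp_of_mem hx, hνv, ← ENNReal.ofReal_mul h.pos.le] at hle
  have h2 := ENNReal.le_sub_of_add_le_right ENNReal.ofReal_ne_top hle
  rw [← ENNReal.ofReal_sub _ (mul_nonneg h.pos.le hv)] at h2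
  rw [ENNReal.ofReal_div_of_pos hβ', ENNReal.le_div_iff_mul_le (by simp [hβ]) (by simp), mul_comm]
  exact h2

/-- A bound for the regeneration potential in terms of the potential up to the first visit of
`C`. -/
lemma regenPotential_le_add (h : Minorization P C β ν) (hβ : β < 1) {r : ℝ} (hr : 1 ≤ r)
    {W : S → ℝ≥0∞} (hW : Measurable W) {c : ℝ≥0∞}
    (hc : ∀ x ∈ C, residualOp P C β ν (potential P C (ENNReal.ofReal r) W) x +
      c * residualOp P C β ν (hitGen P C r) x ≤ c) (x : S) :
    regenPotential h hβ (ENNReal.ofReal r) W x ≤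
      potential P C (ENNReal.ofReal r) W x + c * hitGen P C r x := by
  have hC := h.measurableSet
  have hp : Measurable (potential P C (ENNReal.ofReal r) W) := measurable_potential hC hW
  have hg : Measurable (hitGen P C r) := measurable_hitGen hC r
  refine regenPotential_le (Φ := fun x => potential P C (ENNReal.ofReal r) W x + c * hitGen P C r x)
    hW (hp.add (hg.const_mul c)) (fun x => ?_) x
  rw [residualOp_add hp, residualOp_const_mul hg]
  -- On `C`, `hitGen` is `r`, so the required inequality is `r` times `hc`. Off `C` both potentials
  -- satisfy their one-step equations and equality holds.
  by_cases hx : x ∈ C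
  · rw [potential_of_mem hC hW hx, hitGen_of_mem hC hr hx, mul_comm c (ENNReal.ofReal r)]
    gcongr
    exact hc x hx
  · rw [residualOp_of_notMem hx, residualOp_of_notMem hx, potential_of_notMem hC hW hx,
      hitGen_of_notMem hC hr hx]
    exact le_of_eq (by ring)

end SplitBounds

/-! ### Bounds up to regeneration -/

section RegenerationBounds

variable {S : Type*} [MeasurableSpace S] {P : Kernel S S} {C : Set S} {β : ℝ}
  {ν : Measure S} {V : S → ℝ} {lam K : ℝ}

lemma lintegral_le_of_le_affine (hV : Drift P C V lam K) {f : S → ℝ≥0∞} {a b : ℝ} (ha : 0 ≤ a)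
    (hb : 0 ≤ b) (hba : b ≤ a) (hf : ∀ x, f x ≤ ENNReal.ofReal (a * V x - b)) {μ : Measure S}
    [IsProbabilityMeasure μ] {k : ℝ} (hk : ∫⁻ y, ENNReal.ofReal (V y) ∂μ ≤ ENNReal.ofReal k) :
    ∫⁻ y, f y ∂μ ≤ ENNReal.ofReal (a * k - b) :=
  (lintegral_mono hf).trans (lintegral_ofReal_affine_le ha hb
    (fun x => by nlinarith [hV.one_le x]) hk)

lemma residualOp_hitGen_le {r ρ : ℝ} {x : S} (hx : x ∈ C)
    (hρ : ∫⁻ y, hitGen P C r y ∂stepMeasure P C β ν (x, false) ≤ ENNReal.ofReal ρ) (hβ : β < 1) :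
    residualOp P C β ν (hitGen P C r) x ≤ ENNReal.ofReal ((1 - β) * ρ) := by
  rw [residualOp_of_mem hx, ENNReal.ofReal_mul (by linarith)]
  gcongr

variable [IsMarkovKernel P]

lemma lintegral_hitGen_le (hC : MeasurableSet C) (hV : Drift P C V lam K) (hlam : 0 < lam)
    {r : ℝ} (hr : 1 ≤ r) (hrl : r ≤ lam⁻¹) {μ : Measure S} [IsProbabilityMeasure μ] {k : ℝ}
    (hk : ∫⁻ y, ENNReal.ofReal (V y) ∂μ ≤ ENNReal.ofReal k) :
    ∫⁻ y, hitGen P C r y ∂μ ≤ ENNReal.ofReal (r ^ (1 + Real.log k / Real.log lam⁻¹)) := by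
  obtain ⟨hθ, hθ1⟩ := exponent_mem hlam hV.lt_one hr hrl
  have hr0 : 0 < r := by linarith
  have hk1 := one_le_of_lintegral_ofReal_le hV.one_le hk
  rw [← mul_rpow_exponent hr0 (by linarith), ENNReal.ofReal_mul hr0.le]
  refine (lintegral_mono (hitGen_le hC hV hlam hr hθ hθ1
    (mul_rpow_exponent_eq_one hlam hV.lt_one hr0).le)).trans ?_
  simp only [ENNReal.ofReal_mul hr0.le]
  rw [lintegral_const_mul' _ _ ENNReal.ofReal_ne_top]
  gcongr
  exact lintegral_ofReal_rpow_le hV.measurable hV.one_le hθ hθ1 hk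

lemma Gtilde_le (h : Minorization P C β ν) (hβ : β < 1) (hV : Drift P C V lam K) (hlam : 0 < lam)
    {r : ℝ} (hr : 1 ≤ r) (hrl : r ≤ lam⁻¹) {k : ℝ}
    (hk : ∀ x ∈ C, ∫⁻ y, ENNReal.ofReal (V y) ∂stepMeasure P C β ν (x, false) ≤
      ENNReal.ofReal k) :
    Gtilde h hβ r ≤ ENNReal.ofReal (r ^ (1 + Real.log k / Real.log lam⁻¹)) := by
  refine iSup₂_le fun x hx => (genFun_splitKernel_le h hβ hr (x, false)).trans ?_
  have := isProbabilityMeasure_stepMeasure h hβ (x, false)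
  exact lintegral_hitGen_le h.measurableSet hV hlam hr hrl (hk x hx)

lemma Horig_eq (hC : MeasurableSet C) (hV : Measurable V) {r : ℝ} (hr : 0 ≤ r) (x : S) :
    Horig P C V r x = ENNReal.ofReal r *
      ∫⁻ y, potential P C (ENNReal.ofReal r) (fun z => ENNReal.ofReal (V z)) y ∂P x :=
  sumFun_eq hC hV hr x

lemma Gorig_ne_top (hC : MeasurableSet C) (hV : Drift P C V lam K) (hlam : 0 < lam)
    {r : ℝ} (hr : 1 ≤ r) (hrl : r ≤ lam⁻¹) (x : S) : Gorig P C r x ≠ ⊤ := by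
  obtain ⟨k, hk⟩ := exists_lintegral_drift_le hV x
  rw [Gorig_eq hC hr]
  exact ne_top_of_le_ne_top ENNReal.ofReal_ne_top (lintegral_hitGen_le hC hV hlam hr hrl hk)

lemma lintegral_potential_le (hC : MeasurableSet C) (hV : Drift P C V lam K) (hlam : 0 < lam)
    {r : ℝ} (hr : 1 ≤ r) (hrl : r * lam < 1) {μ : Measure S} [IsProbabilityMeasure μ] {k : ℝ}
    (hk : ∫⁻ y, ENNReal.ofReal (V y) ∂μ ≤ ENNReal.ofReal k) :
    ∫⁻ y, potential P C (ENNReal.ofReal r) (fun z => ENNReal.ofReal (V z)) y ∂μ ≤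
      ENNReal.ofReal (1 / (1 - r * lam) * k - r * lam / (1 - r * lam)) := by
  have h1 : 0 < 1 - r * lam := by linarith
  exact lintegral_le_of_le_affine hV (by positivity) (by positivity) (by gcongr)
    (potential_drift_le hC hV hlam hr hrl) hk

lemma Horig_ne_top (hC : MeasurableSet C) (hV : Drift P C V lam K) (hlam : 0 < lam)
    {r : ℝ} (hr : 1 ≤ r) (hrl : r * lam < 1) (x : S) : Horig P C V r x ≠ ⊤ := by
  obtain ⟨k, hk⟩ := exists_lintegral_drift_le hV x
  rw [Horig_eq hC hV.measurable (by linarith)]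
  exact ENNReal.mul_ne_top ENNReal.ofReal_ne_top
    (ne_top_of_le_ne_top ENNReal.ofReal_ne_top (lintegral_potential_le hC hV hlam hr hrl hk))

variable {h : Minorization P C β ν} {hβ : β < 1} {v : ℝ}

lemma residualOp_le_of_le_affine (h : Minorization P C β ν) (hβ : β < 1) (hV : Drift P C V lam K)
    (hv : 1 ≤ v) (hνv : ∫⁻ y, ENNReal.ofReal (V y) ∂ν = ENNReal.ofReal v) {f : S → ℝ≥0∞} {a b : ℝ}
    (ha : 0 ≤ a) (hb : 0 ≤ b) (hba : b ≤ a) (hf : ∀ x, f x ≤ ENNReal.ofReal (a * V x - b)) {x : S}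
    (hx : x ∈ C) :
    residualOp P C β ν f x ≤ ENNReal.ofReal (a * (K - β * v) - (1 - β) * b) := by
  have := isProbabilityMeasure_stepMeasure h hβ (x, false)
  have hβ' : 0 < 1 - β := by linarith
  have h1 := lintegral_le_of_le_affine hV ha hb hba hf
    (h.lintegral_stepMeasure_le hβ hV (by linarith) hνv hx)
  rw [residualOp_of_mem hx]
  refine (mul_le_mul_right h1 _).trans (le_of_eq ?_)
  rw [← ENNReal.ofReal_mul hβ'.le]
  congr 1
  field_simp

lemma residualOp_potential_le (h : Minorization P C β ν) (hβ : β < 1) (hV : Drift P C V lam K)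
    (hlam : 0 < lam) {r : ℝ} (hr : 1 ≤ r) (hrl : r * lam < 1) (hv : 1 ≤ v)
    (hνv : ∫⁻ y, ENNReal.ofReal (V y) ∂ν = ENNReal.ofReal v) {x : S} (hx : x ∈ C) :
    residualOp P C β ν (potential P C (ENNReal.ofReal r) (fun z => ENNReal.ofReal (V z))) x ≤
      ENNReal.ofReal ((K - β * v - (1 - β) * (r * lam)) / (1 - r * lam)) := by
  have h1 : 0 < 1 - r * lam := by linarith
  refine (residualOp_le_of_le_affine h hβ hV hv hνv (by positivity) (by positivity) (by gcongr)
    (potential_drift_le h.measurableSet hV hlam hr hrl) hx).trans (le_of_eq ?_)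
  congr 1
  field_simp

/-- Since `(r - 1)` times the potential of 1 is `hitGen - 1`, the bound carries `ρ - 1` instead of
`ρ`; this produces the factor `r ^ α₁ - 1` in the difference quotient. -/
lemma mul_residualOp_potential_one_le (h : Minorization P C β ν) (hβ : β < 1) {r ρ : ℝ} {x : S}
    (hx : x ∈ C) (hρ1 : 1 ≤ ρ)
    (hρ : ∫⁻ y, hitGen P C r y ∂stepMeasure P C β ν (x, false) ≤ ENNReal.ofReal ρ) :
    ENNReal.ofReal (r - 1) * residualOp P C β ν (potential P C (ENNReal.ofReal r) fun _ => 1) x ≤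
      ENNReal.ofReal ((1 - β) * (ρ - 1)) := by
  have := isProbabilityMeasure_stepMeasure h hβ (x, false)
  have hβ' : 0 < 1 - β := by linarith
  rw [lintegral_hitGen h.measurableSet, ← ENNReal.le_sub_iff_add_le_left (by simp)
    (by simpa using hρ1)] at hρ
  rw [residualOp_of_mem hx, mul_left_comm, ENNReal.ofReal_mul hβ'.le,
    ENNReal.ofReal_sub ρ zero_le_one, ENNReal.ofReal_one]
  gcongr

variable {r ρ : ℝ}

lemma regenPotential_drift_le (hV : Drift P C V lam K) (hlam : 0 < lam) (hr : 1 ≤ r)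
    (hrl : r * lam < 1) (hv : 1 ≤ v) (hvK : β * v + (1 - β) ≤ K)
    (hνv : ∫⁻ y, ENNReal.ofReal (V y) ∂ν = ENNReal.ofReal v) (hρ0 : 0 ≤ ρ)
    (hρ : ∀ x ∈ C, ∫⁻ y, hitGen P C r y ∂stepMeasure P C β ν (x, false) ≤ ENNReal.ofReal ρ)
    (hD : 0 < 1 - (1 - β) * ρ) (x : S) :
    regenPotential h hβ (ENNReal.ofReal r) (fun z => ENNReal.ofReal (V z)) x ≤
      potential P C (ENNReal.ofReal r) (fun z => ENNReal.ofReal (V z)) x +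
      ENNReal.ofReal ((K - β * v - (1 - β) * (r * lam)) / ((1 - r * lam) * (1 - (1 - β) * ρ))) *
        hitGen P C r x := by
  have h1 : 0 < 1 - r * lam := by linarith
  have hβ' : 0 < 1 - β := by linarith
  have hb : 0 ≤ K - β * v - (1 - β) * (r * lam) := by nlinarith
  -- The coefficient `c` solves `c = (K - βv - (1 - β)rλ) / (1 - rλ) + c (1 - β) ρ`.
  refine regenPotential_le_add h hβ hr hV.measurable.ennreal_ofReal (fun x hx => ?_) x
  refine (add_le_add (residualOp_potential_le h hβ hV hlam hr hrl hv hνv hx)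
    (mul_le_mul_right (residualOp_hitGen_le hx (hρ x hx) hβ) _)).trans (le_of_eq ?_)
  rw [← ENNReal.ofReal_mul (by positivity), ← ENNReal.ofReal_add (by positivity) (by positivity)]
  congr 1
  field_simp
  ring

/-- The total mass bound: `1 + (r - 1) J ≤ β / (1 - (1 - β) ρ) · hitGen`, where `J` is the
regeneration potential of the constant `1`. -/
lemma regenPotential_one_le (hr : 1 < r) (hρ1 : 1 ≤ ρ)
    (hρ : ∀ x ∈ C, ∫⁻ y, hitGen P C r y ∂stepMeasure P C β ν (x, false) ≤ ENNReal.ofReal ρ)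
    (hD : 0 < 1 - (1 - β) * ρ) (x : S) :
    1 + ENNReal.ofReal (r - 1) * regenPotential h hβ (ENNReal.ofReal r) (fun _ => 1) x ≤
      ENNReal.ofReal (β / (1 - (1 - β) * ρ)) * hitGen P C r x := by
  have h1 : 0 < r - 1 := by linarith
  have hβ' : 0 < 1 - β := by linarith
  have hρ' : 0 ≤ ρ - 1 := by linarith
  -- Solution of `c = (1 - β)(ρ - 1) / (r - 1) + c (1 - β) ρ`; then `1 + (r - 1) c = β / (1 - (1 -
  -- β) ρ)`.
  set c := (1 - β) * (ρ - 1) / ((r - 1) * (1 - (1 - β) * ρ)) with hc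
  have hc0 : 0 ≤ c := by positivity
  have hle := regenPotential_le_add h hβ hr.le (W := fun _ => 1) measurable_const
    (c := ENNReal.ofReal c) (fun x hx => ?_) x
  · refine (add_le_add_right (mul_le_mul_right hle _) 1).trans (le_of_eq ?_)
    rw [mul_add, ← add_assoc, ← mul_assoc, ← ENNReal.ofReal_mul h1.le, ← hitGen]
    nth_rw 1 [← one_mul (hitGen P C r x)]
    rw [← add_mul, ← ENNReal.ofReal_one, ← ENNReal.ofReal_add zero_le_one (by positivity)]
    congr 2
    rw [hc]
    field_simp
    ring
  · have h2 := mul_residualOp_potential_one_le h hβ hx hρ1 (hρ x hx)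
    have h3 : residualOp P C β ν (potential P C (ENNReal.ofReal r) fun _ => 1) x ≤
        ENNReal.ofReal ((1 - β) * (ρ - 1) / (r - 1)) := by
      rw [ENNReal.ofReal_div_of_pos h1,
        ENNReal.le_div_iff_mul_le (by simp [hr]) (by simp), mul_comm]
      exact h2
    refine (add_le_add h3 (mul_le_mul_right (residualOp_hitGen_le hx (hρ x hx) hβ) _)).trans
      (le_of_eq ?_)
    rw [← ENNReal.ofReal_mul hc0, ← ENNReal.ofReal_add (by positivity) (by positivity)]
    congr 1
    rw [hc]
    field_simp
    ring

/-- Comparison of the regeneration potentials of `V` for the weights `r` and `1`. -/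
lemma regenPotential_le_regenPotential_one (hV : Drift P C V lam K) (hlam : 0 < lam) (hr : 1 ≤ r)
    (hrl : r * lam < 1) (hv : 1 ≤ v) (hvK : β * v + (1 - β) ≤ K)
    (hνv : ∫⁻ y, ENNReal.ofReal (V y) ∂ν = ENNReal.ofReal v) (hρ1 : 1 ≤ ρ)
    (hρ : ∀ x ∈ C, ∫⁻ y, hitGen P C r y ∂stepMeasure P C β ν (x, false) ≤ ENNReal.ofReal ρ)
    (hD : 0 < 1 - (1 - β) * ρ) {q c e : ℝ}
    (hq : q = lam / ((1 - lam) * (1 - r * lam)))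
    (hc : c = (K - β - (1 - β) * lam) / ((1 - lam) * β))
    (he : e = ((r - 1) * (q * (K - β * v - (1 - β))) + c * (1 - β) * (ρ - 1)) /
      (1 - (1 - β) * ρ)) (x : S) :
    regenPotential h hβ (ENNReal.ofReal r) (fun z => ENNReal.ofReal (V z)) x ≤
      regenPotential h hβ 1 (fun z => ENNReal.ofReal (V z)) x +
      (ENNReal.ofReal (r - 1) * ENNReal.ofReal (q * V x - q) +
      (ENNReal.ofReal c * (ENNReal.ofReal (r - 1) * potential P C (ENNReal.ofReal r) (fun _ => 1) x)
      + ENNReal.ofReal e * hitGen P C r x)) := by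
  have hβ0 := h.pos
  have hC := h.measurableSet
  have h1 : 0 < 1 - r * lam := by linarith
  have hl : 0 < 1 - lam := by linarith [hV.lt_one]
  have hβ' : 0 < 1 - β := by linarith
  have hr1 : 0 ≤ r - 1 := by linarith
  have hρ' : 0 ≤ ρ - 1 := by linarith
  have hq0 : 0 ≤ q := by rw [hq]; positivity
  have hKv : 0 ≤ K - β * v - (1 - β) := by linarith
  have hcn : 0 ≤ K - β - (1 - β) * lam := by nlinarith
  have hc0 : 0 ≤ c := by rw [hc]; positivity
  have he0 : 0 ≤ e := by rw [he]; positivity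
  set J := regenPotential h hβ 1 (fun z => ENNReal.ofReal (V z)) with hJ
  set m := potential P C (ENNReal.ofReal r) (fun _ => 1) with hm
  set Q : S → ℝ≥0∞ := fun x => ENNReal.ofReal (q * V x - q) with hQ
  have hVm : Measurable fun z => ENNReal.ofReal (V z) := hV.measurable.ennreal_ofReal
  have hJm : Measurable J := measurable_regenPotential hVm
  have hmm : Measurable m := measurable_potential hC measurable_const
  have hgm : Measurable (hitGen P C r) := measurable_hitGen hC r
  have hQm : Measurable Q := ((hV.measurable.const_mul q).sub_const q).ennreal_ofReal
  -- the potential for `r = 1`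
  have hJle : ∀ x, J x ≤ potential P C 1 (fun z => ENNReal.ofReal (V z)) x + ENNReal.ofReal c := by
    intro x
    -- At `r = 1` one may take `ρ = 1`, and the denominator `1 - (1 - β) ρ` becomes `β`. Replacing
    -- `v` by 1 then gives `c`.
    have := regenPotential_drift_le (h := h) (hβ := hβ) (r := 1) (ρ := 1) hV hlam le_rfl
      (by linarith) hv hvK hνv zero_le_one
      (fun x _ => by
        have := isProbabilityMeasure_stepMeasure h hβ (x, false)
        simp [hitGen_one]) (by linarith) x
    rw [ENNReal.ofReal_one, hitGen_one, mul_one] at this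
    refine this.trans (add_le_add_right (ENNReal.ofReal_le_ofReal ?_) _)
    rw [hc, one_mul, mul_one, sub_sub_cancel]
    gcongr
    nlinarith
  have hRJ : ∀ x ∈ C, residualOp P C β ν J x ≤ ENNReal.ofReal c := by
    intro x hx
    refine (residualOp_mono hJle x).trans ?_
    rw [residualOp_add (measurable_potential hC hVm), residualOp_const h hβ, labelProb_of_mem hx]
    have := residualOp_potential_le h hβ hV hlam (r := 1) le_rfl (by linarith) hv hνv hx
    rw [ENNReal.ofReal_one, one_mul] at this
    refine (add_le_add_left this _).trans ?_
    rw [← ENNReal.ofReal_mul hβ'.le, ← ENNReal.ofReal_add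
      (div_nonneg (by nlinarith) hl.le) (by positivity)]
    refine ENNReal.ofReal_le_ofReal ?_
    have : (K - β * v - (1 - β) * lam) / (1 - lam) ≤ (K - β - (1 - β) * lam) / (1 - lam) := by
      gcongr
      nlinarith
    have h2 : (K - β - (1 - β) * lam) / (1 - lam) = β * c := by rw [hc]; field_simp
    linarith
  have hPJ : ∀ x ∉ C, ∫⁻ y, J y ∂P x ≤
      ENNReal.ofReal (lam * (V x - 1) / (1 - lam)) + ENNReal.ofReal c := by
    intro x hx
    refine (lintegral_mono hJle).trans ?_
    rw [lintegral_add_right _ measurable_const]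
    have := lintegral_potential_le hC hV hlam (r := 1) le_rfl (by linarith) (hV.of_notMem x hx)
    rw [ENNReal.ofReal_one, one_mul] at this
    refine add_le_add (this.trans (le_of_eq ?_)) (by simp)
    congr 1
    field_simp
  have hPQ : ∀ x ∉ C, ∫⁻ y, Q y ∂P x ≤ ENNReal.ofReal (q * (lam * V x) - q) := fun x hx =>
    lintegral_le_of_le_affine hV hq0 hq0 le_rfl (fun _ => le_rfl) (hV.of_notMem x hx)
  have hRQ : ∀ x ∈ C, residualOp P C β ν Q x ≤ ENNReal.ofReal (q * (K - β * v - (1 - β))) := by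
    intro x hx
    refine (residualOp_le_of_le_affine h hβ hV hv hνv hq0 hq0 le_rfl (fun _ => le_rfl) hx).trans
      (le_of_eq ?_)
    congr 1
    ring
  -- Passing from weight 1 to `r` creates the source `(r - 1) R J`. Off `C` it is at most `r - 1`
  -- times `λ(V - 1) / (1 - λ) + c`: `Q` absorbs the first part and `c m` the constant. On `C` it is
  -- at most `(r - 1) c`, absorbed by `c m` as `m = 1` there; `e u` pays for what `Q`, `m` and `u`
  -- contribute after a step from `C`.
  refine regenPotential_le (Φ := fun x => J x + (ENNReal.ofReal (r - 1) * Q x +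
    (ENNReal.ofReal c * (ENNReal.ofReal (r - 1) * m x) + ENNReal.ofReal e * hitGen P C r x)))
    hVm (hJm.add ((hQm.const_mul _).add (((hmm.const_mul _).const_mul _).add (hgm.const_mul _))))
    (fun x => ?_) x
  rw [residualOp_add hJm, residualOp_add (hQm.const_mul _),
    residualOp_add ((hmm.const_mul _).const_mul _), residualOp_const_mul hQm,
    residualOp_const_mul (hmm.const_mul _), residualOp_const_mul hmm, residualOp_const_mul hgm]
  have hJx : J x = ENNReal.ofReal (V x) + residualOp P C β ν J x := by
    rw [hJ, regenPotential_eq hVm, one_mul]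
  rw [hJx]
  have hrr : ENNReal.ofReal r = 1 + ENNReal.ofReal (r - 1) := (ofReal_one_add_sub hr).symm
  by_cases hx : x ∈ C
  · have hmx : m x = 1 := potential_of_mem hC measurable_const hx
    rw [hitGen_of_mem hC hr hx, hmx, mul_one]
    have hmR := mul_residualOp_potential_one_le h hβ hx hρ1 (hρ x hx)
    have hgR := residualOp_hitGen_le hx (hρ x hx) hβ
    -- The coefficient `e` is the fixed point `e = (r - 1) q (K - βv - (1 - β)) + c (1 - β)(ρ - 1) +
    -- e (1 - β) ρ`.
    have hsum : ENNReal.ofReal (r - 1) * residualOp P C β ν Q x +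
        (ENNReal.ofReal c * (ENNReal.ofReal (r - 1) * residualOp P C β ν m x) +
          ENNReal.ofReal e * residualOp P C β ν (hitGen P C r) x) ≤ ENNReal.ofReal e := by
      refine (add_le_add (mul_le_mul_right (hRQ x hx) _) (add_le_add (mul_le_mul_right hmR _)
        (mul_le_mul_right hgR _))).trans (le_of_eq ?_)
      rw [← ENNReal.ofReal_mul hr1, ← ENNReal.ofReal_mul hc0, ← ENNReal.ofReal_mul he0,
        ← ENNReal.ofReal_add (by positivity) (by positivity),
        ← ENNReal.ofReal_add (by positivity) (by positivity)]
      congr 1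
      rw [he]
      field_simp
      ring
    calc ENNReal.ofReal (V x) + ENNReal.ofReal r * (residualOp P C β ν J x +
          (ENNReal.ofReal (r - 1) * residualOp P C β ν Q x +
          (ENNReal.ofReal c * (ENNReal.ofReal (r - 1) * residualOp P C β ν m x) +
          ENNReal.ofReal e * residualOp P C β ν (hitGen P C r) x)))
        ≤ ENNReal.ofReal (V x) + (residualOp P C β ν J x + ENNReal.ofReal (r - 1) *
          ENNReal.ofReal c + ENNReal.ofReal r * ENNReal.ofReal e) := by
          rw [mul_add]
          gcongr
          rw [hrr, add_mul, one_mul]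
          gcongr
          exact hRJ x hx
      _ ≤ _ := by
          rw [add_assoc, ← add_assoc (ENNReal.ofReal (V x))]
          refine add_le_add le_rfl (le_add_of_nonneg_of_le zero_le (le_of_eq ?_))
          ring
  · have hmx : m x = 1 + ENNReal.ofReal r * ∫⁻ y, m y ∂P x :=
      potential_of_notMem hC measurable_const hx
    have hgx := hitGen_of_notMem (P := P) hC hr hx
    simp only [residualOp_of_notMem hx]
    have hk := one_le_of_lintegral_ofReal_le hV.one_le (hV.of_notMem x hx)
    have hV1 := hV.one_le x
    have hsum : ∫⁻ y, J y ∂P x + ENNReal.ofReal r * ∫⁻ y, Q y ∂P x ≤ Q x + ENNReal.ofReal c := by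
      refine (add_le_add (hPJ x hx) (mul_le_mul_right (hPQ x hx) _)).trans ?_
      rw [add_right_comm]
      gcongr
      have hn1 : 0 ≤ V x - 1 := by linarith
      have hn2 : 0 ≤ q * (lam * V x) - q := by nlinarith
      rw [← ENNReal.ofReal_mul (by linarith), ← ENNReal.ofReal_add (by positivity) (by positivity)]
      refine ENNReal.ofReal_le_ofReal ?_
      have : lam * (V x - 1) / (1 - lam) = q * ((1 - r * lam) * (V x - 1)) := by
        have h1' : 1 - lam * r ≠ 0 := by rw [mul_comm]; exact h1.ne'
        rw [hq]; field_simp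
      rw [this]
      -- With the chosen `q`, the slack is `q r (1 - λ) ≥ 0`.
      nlinarith [mul_nonneg hq0 (mul_nonneg hr1 hl.le), mul_nonneg hq0 hr1]
    calc ENNReal.ofReal (V x) + ENNReal.ofReal r * (∫⁻ y, J y ∂P x +
          (ENNReal.ofReal (r - 1) * ∫⁻ y, Q y ∂P x +
          (ENNReal.ofReal c * (ENNReal.ofReal (r - 1) * ∫⁻ y, m y ∂P x) +
          ENNReal.ofReal e * ∫⁻ y, hitGen P C r y ∂P x)))
        = ENNReal.ofReal (V x) + ∫⁻ y, J y ∂P x + (ENNReal.ofReal (r - 1) *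
          (∫⁻ y, J y ∂P x + ENNReal.ofReal r * ∫⁻ y, Q y ∂P x) +
          (ENNReal.ofReal c * (ENNReal.ofReal (r - 1) * (ENNReal.ofReal r * ∫⁻ y, m y ∂P x)) +
          ENNReal.ofReal e * hitGen P C r x)) := by
          rw [hgx, mul_add (ENNReal.ofReal r) (∫⁻ y, J y ∂P x)]
          conv_lhs => enter [2, 1, 1]; rw [hrr]
          ring
      _ ≤ ENNReal.ofReal (V x) + ∫⁻ y, J y ∂P x + (ENNReal.ofReal (r - 1) *
          (Q x + ENNReal.ofReal c) +
          (ENNReal.ofReal c * (ENNReal.ofReal (r - 1) * (ENNReal.ofReal r * ∫⁻ y, m y ∂P x)) +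
          ENNReal.ofReal e * hitGen P C r x)) := by gcongr
      _ = _ := by rw [hmx]; ring

end RegenerationBounds

end

/-! ### Real inequalities and the final assembly -/

lemma toReal_le_add_mul {a b c : ℝ≥0∞} {t : ℝ} (ht : 0 ≤ t) (hb : b ≠ ⊤) (hc : c ≠ ⊤)
    (h : a ≤ b + ENNReal.ofReal t * c) : a ≠ ⊤ ∧ a.toReal ≤ b.toReal + t * c.toReal := by
  have hfin : ENNReal.ofReal t * c ≠ ⊤ := ENNReal.mul_ne_top ENNReal.ofReal_ne_top hc
  refine ⟨ne_top_of_le_ne_top (ENNReal.add_ne_top.2 ⟨hb, hfin⟩) h, ?_⟩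
  have := ENNReal.toReal_mono (ENNReal.add_ne_top.2 ⟨hb, hfin⟩) h
  rwa [ENNReal.toReal_add hb hfin, ENNReal.toReal_mul, ENNReal.toReal_ofReal ht] at this

/-- The bound for the potential of `V` started from the regeneration measure, from separate bounds
for the first excursion and for the later ones. -/
lemma regeneration_sum_bound {β K s r v ρ₁ ρ₂ : ℝ} (hβ0 : 0 < β) (hβ : β < 1) (hs : s < 1)
    (hr : 0 < r) (hv : s ≤ v) (h1 : 1 ≤ ρ₁) (h2 : 1 ≤ ρ₂) (hD : 0 < 1 - (1 - β) * ρ₁) :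
    r * (1 / (1 - s) * v - s / (1 - s) +
      (K - β * v - (1 - β) * s) / ((1 - s) * (1 - (1 - β) * ρ₁)) * ρ₂) ≤
      r * ρ₂ * (K - s) / ((1 - s) * (1 - (1 - β) * ρ₁)) := by
  have hs' : 0 < 1 - s := by linarith
  set D := 1 - (1 - β) * ρ₁ with hDd
  -- `D = β - (1 - β)(ρ₁ - 1) ≤ β ≤ β ρ₂`. The left side of the goal is therefore nonincreasing in
  -- `v`, and at `v = s` it equals the right side.
  have hDβ : D ≤ β * ρ₂ := by nlinarith
  rw [← sub_nonneg]
  have : r * ρ₂ * (K - s) / ((1 - s) * D) - r * (1 / (1 - s) * v - s / (1 - s) +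
      (K - β * v - (1 - β) * s) / ((1 - s) * D) * ρ₂) =
      r * ((v - s) * (β * ρ₂ - D)) / ((1 - s) * D) := by field_simp; ring
  rw [this]
  have : 0 ≤ (v - s) * (β * ρ₂ - D) := mul_nonneg (by linarith) (by linarith)
  positivity

/-- The bound for `X - r Y` is affine in `v` with slope of the sign of `D - β ρ₂ ≤ 0`, so `v ≥ 1`
allows the value 1, where it equals `r - 1` times the stated right side. -/
lemma regeneration_difference_bound {β K lam r v ρ₁ ρ₂ q c e X Y : ℝ} (hβ0 : 0 < β) (hβ : β < 1)
    (hlam : 0 < lam) (hlam1 : lam < 1) (hrl : r * lam < 1) (hr : 1 < r) (hv : 1 ≤ v)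
    (h1 : 1 ≤ ρ₁) (h2 : 1 ≤ ρ₂) (hD : 0 < 1 - (1 - β) * ρ₁)
    (hq : q = lam / ((1 - lam) * (1 - r * lam)))
    (hc : c = (K - β - (1 - β) * lam) / ((1 - lam) * β))
    (he : e = ((r - 1) * (q * (K - β * v - (1 - β))) + c * (1 - β) * (ρ₁ - 1)) /
      (1 - (1 - β) * ρ₁))
    (hX : X ≤ r * (Y + ((r - 1) * (q * v - q) + (c * (ρ₂ - 1) + e * ρ₂)))) :
    (X - r * Y) / (r - 1) ≤
      r * ρ₂ * lam * (K - 1) / ((1 - lam) * (1 - r * lam) * (1 - (1 - β) * ρ₁)) +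
        r * (K - lam - β * (1 - lam)) / ((1 - lam) * (1 - (1 - β) * ρ₁)) *
          ((ρ₂ - 1) / (r - 1) + (1 - β) * (ρ₁ - 1) / (β * (r - 1))) := by
  have hr1 : 0 < r - 1 := by linarith
  have hs' : 0 < 1 - r * lam := by linarith
  have hl : 0 < 1 - lam := by linarith
  set D := 1 - (1 - β) * ρ₁ with hDd
  have hDβ : D ≤ β * ρ₂ := by nlinarith
  have hq0 : 0 ≤ q := by rw [hq]; positivity
  have hA : r * ρ₂ * lam * (K - 1) / ((1 - lam) * (1 - r * lam) * D) = r * ρ₂ * q * (K - 1) / D := by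
    rw [hq]; field_simp
  have hB : r * (K - lam - β * (1 - lam)) / ((1 - lam) * D) = r * c * β / D := by
    rw [hc]; field_simp; ring
  rw [hA, hB, div_le_iff₀ hr1, ← sub_nonneg]
  have hX' : X - r * Y ≤ r * ((r - 1) * (q * v - q) + (c * (ρ₂ - 1) + e * ρ₂)) := by linarith
  refine le_trans ?_ (sub_le_sub_left hX' _)
  have : (r * ρ₂ * q * (K - 1) / D + r * c * β / D *
      ((ρ₂ - 1) / (r - 1) + (1 - β) * (ρ₁ - 1) / (β * (r - 1)))) * (r - 1) -
      r * ((r - 1) * (q * v - q) + (c * (ρ₂ - 1) + e * ρ₂)) =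
      r * (r - 1) * q * ((v - 1) * (β * ρ₂ - D)) / D := by
    rw [he]
    field_simp
    rw [hDd]
    ring
  rw [this]
  have h3 : 0 ≤ (v - 1) * (β * ρ₂ - D) := mul_nonneg (by linarith) (by linarith)
  positivity

theorem proposition4p4 {S : Type*} [MeasurableSpace S] (P : Kernel S S) [IsMarkovKernel P]
    (C : Set S) (β : ℝ) (ν : Measure S) (V : S → ℝ) (lam K : ℝ)
    (hA1 : Minorization P C β ν) (hβ : β < 1)
    (hA2 : Drift P C V lam K) (hlam : 0 < lam)
    (a : S) (ha : a ∈ C)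
    (α₁ α₂ R₀ : ℝ)
    (hα₁ : α₁ = 1 + Real.log ((K - β) / (1 - β)) / Real.log lam⁻¹)
    (hα₂ : α₂ = 1 + Real.log (K / β) / Real.log lam⁻¹)
    (hR₀ : R₀ = min lam⁻¹ ((1 - β) ^ (-1 / α₁))) :
    (∀ r : ℝ, 1 ≤ r → r ≤ lam⁻¹ →
      Gtilde hA1 hβ r ≠ ⊤ ∧ (Gtilde hA1 hβ r).toReal ≤ r ^ α₁) ∧
    (∀ r : ℝ, 1 < r → r < R₀ →
      -- the bounds that hold for every starting point
      (∀ x : S,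
        (Gorig P C r x ≠ ⊤ ∧ Horig P C V r x ≠ ⊤ ∧
          GbarMix hA1 hβ r x ≠ ⊤ ∧ HbarMix hA1 hβ V r x ≠ ⊤) ∧
        (GbarMix hA1 hβ r x).toReal ≤
          β * (Gorig P C r x).toReal / (1 - (1 - β) * r ^ α₁) ∧
        (HbarMix hA1 hβ V r x).toReal ≤
          (Horig P C V r x).toReal +
            r * (K - r * lam - β * (1 - r * lam)) /
              ((1 - r * lam) * (1 - (1 - β) * r ^ α₁)) * (Gorig P C r x).toReal) ∧
      -- the bounds for the regeneration state
      (Gbar hA1 hβ r a true ≠ ⊤ ∧ Hbar hA1 hβ V r a true ≠ ⊤ ∧ Hbar hA1 hβ V 1 a true ≠ ⊤) ∧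
      (Gbar hA1 hβ r a true).toReal ≤ β * r ^ α₂ / (1 - (1 - β) * r ^ α₁) ∧
      (Hbar hA1 hβ V r a true).toReal ≤
        r ^ (α₂ + 1) * (K - r * lam) / ((1 - r * lam) * (1 - (1 - β) * r ^ α₁)) ∧
      ((Hbar hA1 hβ V r a true).toReal - r * (Hbar hA1 hβ V 1 a true).toReal) / (r - 1) ≤
        r ^ (α₂ + 1) * lam * (K - 1) /
            ((1 - lam) * (1 - r * lam) * (1 - (1 - β) * r ^ α₁)) +
          r * (K - lam - β * (1 - lam)) / ((1 - lam) * (1 - (1 - β) * r ^ α₁)) *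
            ((r ^ α₂ - 1) / (r - 1) + (1 - β) * (r ^ α₁ - 1) / (β * (r - 1)))) := by
  have hC := hA1.measurableSet
  have hνp := hA1.isProbabilityMeasure
  have hβ0 := hA1.pos
  have hβ' : 0 < 1 - β := by linarith
  have hlam1 := hA2.lt_one
  have hl : 0 < 1 - lam := by linarith
  have hVm : Measurable fun z => ENNReal.ofReal (V z) := hA2.measurable.ennreal_ofReal
  obtain ⟨v, hv, hvK0, hνv⟩ := hA1.exists_mean hβ hA2 ha
  have hstep : ∀ x ∈ C, ∫⁻ y, ENNReal.ofReal (V y) ∂stepMeasure P C β ν (x, false) ≤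
      ENNReal.ofReal ((K - β * v) / (1 - β)) := fun x hx =>
    hA1.lintegral_stepMeasure_le hβ hA2 (by linarith) hνv hx
  -- The residual law is a probability and `V ≥ 1`, so its bound `(K - βv) / (1 - β)` is at least 1.
  -- Nonnegativity of the numerators below rests on this.
  have hvK : β * v + (1 - β) ≤ K := by
    have := isProbabilityMeasure_stepMeasure hA1 hβ (a, false)
    have := one_le_of_lintegral_ofReal_le hA2.one_le (hstep a ha)
    rw [le_div_iff₀ hβ'] at this
    linarith
  have hstep' : ∀ x ∈ C, ∫⁻ y, ENNReal.ofReal (V y) ∂stepMeasure P C β ν (x, false) ≤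
      ENNReal.ofReal ((K - β) / (1 - β)) := fun x hx =>
    (hstep x hx).trans (ENNReal.ofReal_le_ofReal (by gcongr; nlinarith))
  have hνK : ∫⁻ y, ENNReal.ofReal (V y) ∂ν ≤ ENNReal.ofReal (K / β) := by
    rw [hνv]
    refine ENNReal.ofReal_le_ofReal ?_
    rw [le_div_iff₀ hβ0]
    linarith
  have hloginv : 0 < Real.log lam⁻¹ := Real.log_pos (by rw [one_lt_inv₀ hlam]; exact hlam1)
  have hα₁1 : 1 ≤ α₁ := by
    rw [hα₁]
    have : 1 ≤ (K - β) / (1 - β) := by rw [le_div_iff₀ hβ']; nlinarith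
    linarith [div_nonneg (Real.log_nonneg this) hloginv.le]
  have hα₂1 : 1 ≤ α₂ := by
    rw [hα₂]
    have : 1 ≤ K / β := by rw [le_div_iff₀ hβ0]; nlinarith
    linarith [div_nonneg (Real.log_nonneg this) hloginv.le]
  refine ⟨fun r hr hrl => ?_, fun r hr hrR => ?_⟩
  · have hle := Gtilde_le hA1 hβ hA2 hlam hr hrl hstep'
    rw [← hα₁] at hle
    exact ⟨ne_top_of_le_ne_top ENNReal.ofReal_ne_top hle,
      ENNReal.toReal_le_of_le_ofReal (by positivity) hle⟩
  have hr0 : 0 < r := by linarith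
  have hrl : r < lam⁻¹ := hrR.trans_le (hR₀ ▸ min_le_left _ _)
  have hrlam : r * lam < 1 := by rwa [lt_inv_comm₀ hr0 hlam, inv_eq_one_div, lt_div_iff₀ hr0,
    mul_comm] at hrl
  have hD : 0 < 1 - (1 - β) * r ^ α₁ := by
    -- Raised to the power `α₁`, this half of `r < R₀` says that the geometric series over failed
    -- regenerations converges.
    have h1 : r < (1 - β) ^ (-1 / α₁) := hrR.trans_le (hR₀ ▸ min_le_right _ _)
    have h2 := Real.rpow_lt_rpow hr0.le h1 (by linarith : 0 < α₁)
    rw [← Real.rpow_mul hβ'.le, div_mul_cancel₀ _ (by linarith), Real.rpow_neg_one] at h2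
    have h3 := mul_lt_mul_of_pos_left h2 hβ'
    rw [mul_inv_cancel₀ hβ'.ne'] at h3
    linarith
  have hρ₁ : 1 ≤ r ^ α₁ := Real.one_le_rpow hr.le (by linarith)
  have hρ₂ : 1 ≤ r ^ α₂ := Real.one_le_rpow hr.le (by linarith)
  have hρ₂' : r ^ (α₂ + 1) = r * r ^ α₂ := by rw [Real.rpow_add_one hr0.ne', mul_comm]
  have hstepG : ∀ x ∈ C, ∫⁻ y, hitGen P C r y ∂stepMeasure P C β ν (x, false) ≤
      ENNReal.ofReal (r ^ α₁) := fun x hx => by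
    have := isProbabilityMeasure_stepMeasure hA1 hβ (x, false)
    rw [hα₁]
    exact lintegral_hitGen_le hC hA2 hlam hr.le hrl.le (hstep' x hx)
  have hνG : ∫⁻ y, hitGen P C r y ∂ν ≤ ENNReal.ofReal (r ^ α₂) := by
    rw [hα₂]
    exact lintegral_hitGen_le hC hA2 hlam hr.le hrl.le hνK
  rw [hρ₂']
  -- From here the powers matter only through being at least 1, through `hD`, and through the bounds
  -- `hstepG` and `hνG`.
  generalize r ^ α₁ = ρ₁ at *
  generalize r ^ α₂ = ρ₂ at *
  have hs' : 0 < 1 - r * lam := by linarith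
  have hgm : Measurable (hitGen P C r) := measurable_hitGen hC r
  have hpm : Measurable (potential P C (ENNReal.ofReal r) fun z => ENNReal.ofReal (V z)) :=
    measurable_potential hC hVm
  have hb : 0 ≤ K - β * v - (1 - β) * (r * lam) := by nlinarith
  have hb1 : 0 ≤ K - r * lam - β * (1 - r * lam) := by nlinarith
  have hJ := regenPotential_drift_le (h := hA1) (hβ := hβ) hA2 hlam hr.le hrlam hv hvK hνv
    (by linarith) hstepG hD
  have hJ1 := regenPotential_one_le (h := hA1) (hβ := hβ) hr hρ₁ hstepG hD
  have hG : ∀ (μ : Measure S) [IsProbabilityMeasure μ], 1 + ENNReal.ofReal (r - 1) *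
      ∫⁻ y, regenPotential hA1 hβ (ENNReal.ofReal r) (fun _ => 1) y ∂μ ≤
      ENNReal.ofReal (β / (1 - (1 - β) * ρ₁)) * ∫⁻ y, hitGen P C r y ∂μ := by
    intro μ _
    have := lintegral_mono (μ := μ) hJ1
    rwa [lintegral_add_left measurable_const, lintegral_const_mul _ hgm, lintegral_const_mul _
      (measurable_regenPotential measurable_const), lintegral_one, measure_univ] at this
  have hH : ∀ (μ : Measure S), ∫⁻ y, regenPotential hA1 hβ (ENNReal.ofReal r)
      (fun z => ENNReal.ofReal (V z)) y ∂μ ≤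
      ∫⁻ y, potential P C (ENNReal.ofReal r) (fun z => ENNReal.ofReal (V z)) y ∂μ +
      ENNReal.ofReal ((K - β * v - (1 - β) * (r * lam)) /
        ((1 - r * lam) * (1 - (1 - β) * ρ₁))) * ∫⁻ y, hitGen P C r y ∂μ := by
    intro μ
    have := lintegral_mono (μ := μ) hJ
    rwa [lintegral_add_left hpm, lintegral_const_mul _ hgm] at this
  have hνpot := lintegral_potential_le (μ := ν) hC hA2 hlam hr.le hrlam hνv.le
  have hpot0 : 0 ≤ 1 / (1 - r * lam) * v - r * lam / (1 - r * lam) := by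
    rw [div_mul_eq_mul_div, ← sub_div]
    exact div_nonneg (by linarith) hs'.le
  have hHa : Hbar hA1 hβ V r a true ≤ ENNReal.ofReal (r * (1 / (1 - r * lam) * v -
      r * lam / (1 - r * lam) + (K - β * v - (1 - β) * (r * lam)) /
        ((1 - r * lam) * (1 - (1 - β) * ρ₁)) * ρ₂)) := by
    rw [Hbar_eq hA2.measurable hr0.le, stepMeasure_true, ENNReal.ofReal_mul hr0.le,
      ENNReal.ofReal_add hpot0 (by positivity), ENNReal.ofReal_mul (by positivity)]
    refine mul_le_mul_right ((hH ν).trans (add_le_add hνpot (mul_le_mul_right hνG _))) _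
  have hH1 : Hbar hA1 hβ V 1 a true =
      ∫⁻ y, regenPotential hA1 hβ 1 (fun z => ENNReal.ofReal (V z)) y ∂ν := by
    rw [Hbar_eq hA2.measurable zero_le_one, stepMeasure_true, ENNReal.ofReal_one, one_mul]
  have hH1top : Hbar hA1 hβ V 1 a true ≠ ⊤ := by
    rw [hH1]
    have h1 := regenPotential_drift_le (h := hA1) (hβ := hβ) (r := 1) (ρ := 1) hA2 hlam le_rfl
      (by linarith) hv hvK hνv zero_le_one
      (fun x _ => by
        have := isProbabilityMeasure_stepMeasure hA1 hβ (x, false)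
        simp [hitGen_one]) (by linarith)
    have h2 := lintegral_potential_le (μ := ν) hC hA2 hlam (r := 1) le_rfl (by linarith) hνv.le
    rw [ENNReal.ofReal_one] at h1 h2
    simp only [hitGen_one, mul_one] at h1
    refine ne_top_of_le_ne_top ?_ (lintegral_mono h1)
    rw [lintegral_add_right _ measurable_const]
    exact ENNReal.add_ne_top.2 ⟨ne_top_of_le_ne_top ENNReal.ofReal_ne_top h2, by simp⟩
  refine ⟨fun x => ?_, ⟨?_, ne_top_of_le_ne_top ENNReal.ofReal_ne_top hHa, hH1top⟩, ?_, ?_, ?_⟩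
  · have hGt := Gorig_ne_top hC hA2 hlam hr.le hrl.le x
    have hHt := Horig_ne_top hC hA2 hlam hr.le hrlam x
    have hGm : GbarMix hA1 hβ r x ≤
        0 + ENNReal.ofReal (β / (1 - (1 - β) * ρ₁)) * Gorig P C r x := by
      rw [GbarMix_eq hr.le, Gorig_eq hC hr.le, zero_add]
      exact hG (P x)
    have hHm : HbarMix hA1 hβ V r x ≤ Horig P C V r x +
        ENNReal.ofReal (r * (K - r * lam - β * (1 - r * lam)) /
          ((1 - r * lam) * (1 - (1 - β) * ρ₁))) * Gorig P C r x := by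
      rw [HbarMix_eq hA2.measurable hr0.le, Horig_eq hC hA2.measurable hr0.le, Gorig_eq hC hr.le]
      refine (mul_le_mul_right (hH (P x)) _).trans ?_
      rw [mul_add, ← mul_assoc, ← ENNReal.ofReal_mul hr0.le, mul_div_assoc]
      refine add_le_add le_rfl (mul_le_mul_left (ENNReal.ofReal_le_ofReal ?_) _)
      refine mul_le_mul_of_nonneg_left (div_le_div_of_nonneg_right ?_ (by positivity)) hr0.le
      -- For a general starting point `v` is simply replaced by its lower bound 1, giving `K - rλ -
      -- β(1 - rλ)`.
      nlinarith
    obtain ⟨h1, h2⟩ := toReal_le_add_mul (by positivity) (by simp) hGt hGm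
    obtain ⟨h3, h4⟩ := toReal_le_add_mul (by positivity) hHt hGt hHm
    refine ⟨⟨hGt, hHt, h1, h3⟩, ?_, h4⟩
    rwa [ENNReal.toReal_zero, zero_add, div_mul_eq_mul_div] at h2
  · rw [Gbar_eq hr.le, stepMeasure_true]
    exact ne_top_of_le_ne_top (ENNReal.mul_ne_top ENNReal.ofReal_ne_top
      (ne_top_of_le_ne_top ENNReal.ofReal_ne_top hνG)) (hG ν)
  · refine ENNReal.toReal_le_of_le_ofReal (by positivity) ?_
    rw [Gbar_eq hr.le, stepMeasure_true, ← div_mul_eq_mul_div, ENNReal.ofReal_mul (by positivity)]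
    exact (hG ν).trans (mul_le_mul_right hνG _)
  · exact (ENNReal.toReal_le_of_le_ofReal (by positivity) hHa).trans
      (regeneration_sum_bound hβ0 hβ hrlam hr0 (by linarith) hρ₁ hρ₂ hD)
  · refine regeneration_difference_bound hβ0 hβ hlam hlam1 hrlam hr hv hρ₁ hρ₂ hD rfl rfl rfl ?_
    have hdiff := regenPotential_le_regenPotential_one (h := hA1) (hβ := hβ) hA2 hlam hr.le hrlam
      hv hvK hνv hρ₁ hstepG hD rfl rfl rfl
    set q := lam / ((1 - lam) * (1 - r * lam)) with hq
    set c := (K - β - (1 - β) * lam) / ((1 - lam) * β) with hc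
    set e := ((r - 1) * (q * (K - β * v - (1 - β))) + c * (1 - β) * (ρ₁ - 1)) /
      (1 - (1 - β) * ρ₁) with he
    have hr1 : 0 < r - 1 := by linarith
    have hρ₁' : 0 ≤ ρ₁ - 1 := by linarith
    have hρ₂'' : 0 ≤ ρ₂ - 1 := by linarith
    have hq0 : 0 ≤ q := by positivity
    have hKv : 0 ≤ K - β * v - (1 - β) := by linarith
    have hcn : 0 ≤ K - β - (1 - β) * lam := by nlinarith
    have hc0 : 0 ≤ c := by positivity
    have he0 : 0 ≤ e := by positivity
    have hqv : 0 ≤ q * v - q := by nlinarith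
    have hmm : Measurable (potential P C (ENNReal.ofReal r) fun _ => 1) :=
      measurable_potential hC measurable_const
    have hνm : ENNReal.ofReal (r - 1) * ∫⁻ y, potential P C (ENNReal.ofReal r) (fun _ => 1) y ∂ν ≤
        ENNReal.ofReal (ρ₂ - 1) := by
      rw [ENNReal.ofReal_sub ρ₂ zero_le_one, ENNReal.ofReal_one]
      refine ENNReal.le_sub_of_add_le_left (by simp) ?_
      rw [← lintegral_hitGen hC]
      exact hνG
    have hle := lintegral_mono (μ := ν) hdiff
    have hQm : Measurable fun x => ENNReal.ofReal (q * V x - q) :=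
      ((hA2.measurable.const_mul q).sub_const q).ennreal_ofReal
    rw [lintegral_add_left (measurable_regenPotential hVm), lintegral_add_left (hQm.const_mul _),
      lintegral_add_left ((hmm.const_mul _).const_mul _), lintegral_const_mul _ hQm,
      lintegral_const_mul _ (hmm.const_mul _), lintegral_const_mul _ hmm,
      lintegral_const_mul _ hgm, ← hH1] at hle
    have hfinal : Hbar hA1 hβ V r a true ≤ ENNReal.ofReal r * (Hbar hA1 hβ V 1 a true +
        ENNReal.ofReal ((r - 1) * (q * v - q) + (c * (ρ₂ - 1) + e * ρ₂))) := by
      rw [Hbar_eq hA2.measurable hr0.le, stepMeasure_true, ENNReal.ofReal_add (by positivity)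
        (by positivity), ENNReal.ofReal_add (by positivity) (by positivity),
        ENNReal.ofReal_mul hr1.le, ENNReal.ofReal_mul hc0, ENNReal.ofReal_mul he0]
      refine mul_le_mul_right (hle.trans ?_) _
      gcongr
      exact lintegral_le_of_le_affine hA2 hq0 hq0 le_rfl (fun _ => le_rfl) hνv.le
    have hfin : Hbar hA1 hβ V 1 a true +
        ENNReal.ofReal ((r - 1) * (q * v - q) + (c * (ρ₂ - 1) + e * ρ₂)) ≠ ⊤ :=
      ENNReal.add_ne_top.2 ⟨hH1top, ENNReal.ofReal_ne_top⟩
    have := ENNReal.toReal_mono (ENNReal.mul_ne_top ENNReal.ofReal_ne_top hfin) hfinal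
    rwa [ENNReal.toReal_mul, ENNReal.toReal_ofReal hr0.le,
      ENNReal.toReal_add hH1top ENNReal.ofReal_ne_top,
      ENNReal.toReal_ofReal (by positivity)] at this
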